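/- There is a universal constant $c>0$ such that the following holds. Let $d,T\ge 1$ be integers, let $\mathcal W\subseteq\mathbb R^d$ be closed and convex, let $\|\cdot\|$ be a norm on $\mathbb R^d$ with dual norm $\|\theta\|_*=\sup\{\langle\theta,w\rangle:\|w\|\le 1\}$, let $r:\mathcal W\to\mathbb R$, and let $R,G_2>0$ and $p_*<\infty$ be real numbers. Two-point bandit mirror descent with step size $\eta$ and exploration parameters $\delta_1,\dots,\delta_T>0$ starts from $\theta_1=0$, and in each round $t=1,\dots,T$, after an adversary has picked a loss $f_t:\mathbb R^d\to\mathbb R$ (possibly at random and depending on everything that happened in earlier rounds), - predicts $w_t=\arg\max_{w\in\mathcal W}\big(\langle\theta_t,w\rangle-r(w)\big)$ (these maximizers are supposed to exist); - samples $u_t$ uniformly from the Euclidean unit sphere of $\mathbb R^d$, independently of the past and of $f_t$; - sets $\tilde g_t=\frac{d}{2\delta_t}\big(f_t(w_t+\delta_t u_t)-f_t(w_t-\delta_t u_t)\big)u_t$ and $\theta_{t+1}=\theta_t-\eta\,\tilde g_t$. Assume that: 1. $r$ is $1$-strongly convex on $\mathcal W$ with respect to $\|\cdot\|$, i.e. $r(ax+by)\le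 a\,r(x)+b\,r(y)-\frac{ab}{2}\|x-y\|^2$ for all $x,y\in\mathcal W$ and $a,b\ge 0$ with $a+b=1$, and $\sup_{x,y\in\mathcal W}\big(r(x)-r(y)\big)\le R^2$ (for example, $0\le r\le R^2$ on $\mathcal W$); 2. each $f_t$ is convex on $\mathbb R^d$ and $G_2$-Lipschitz with respect to the Euclidean norm; 3. $\big(\mathbb E\|u\|_*^4\big)^{1/4}\le p_*$ for $u$ uniform on the Euclidean unit sphere. If $\eta=\frac{R}{p_*G_2\sqrt{dT}}$ and $0<\delta_t\le p_*R\sqrt{d/T}$ for all $t$, then for every $w^*\in\mathcal W$ the average regret against $w^*$ is integrable and $$\mathbb E\Big[\frac1T\sum_{t=1}^T f_t(w_t)-\frac1T\sum_{t=1}^T f_t(w^*)\Big]\le c\,p_*G_2R\sqrt{\frac dT}.$$ -/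

import Mathlib

open MeasureTheory ProbabilityTheory

namespace TwoPointBandit

/-- The dual norm `‖θ‖_* = sup {⟨θ, w⟩ : ‖w‖ ≤ 1}` of a norm `N` on `ℝ^d`. -/
noncomputable def dualNorm {d : ℕ} (N : Seminorm ℝ (EuclideanSpace ℝ (Fin d)))
    (θ : EuclideanSpace ℝ (Fin d)) : ℝ :=
  sSup {a : ℝ | ∃ w : EuclideanSpace ℝ (Fin d), N w ≤ 1 ∧ a = inner ℝ θ w}

/-- `r` is `1`-strongly convex on `W` with respect to the norm `N`. -/
def IsStronglyConvexOn {d : ℕ} (N : Seminorm ℝ (EuclideanSpace ℝ (Fin d)))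
    (W : Set (EuclideanSpace ℝ (Fin d))) (r : EuclideanSpace ℝ (Fin d) → ℝ) : Prop :=
  Convex ℝ W ∧ ∀ x ∈ W, ∀ y ∈ W, ∀ a b : ℝ, 0 ≤ a → 0 ≤ b → a + b = 1 →
    r (a • x + b • y) ≤ a * r x + b * r y - a * b * (1 / 2 * N (x - y) ^ 2)

/-- The uniform probability distribution on the Euclidean unit sphere of `ℝ^d`: the surface
measure, normalized to total mass one, as a measure on `ℝ^d`. -/
noncomputable def uniformSphere (d : ℕ) : Measure (EuclideanSpace ℝ (Fin d)) :=
  let σ : Measure (Metric.sphere (0 : EuclideanSpace ℝ (Fin d)) 1) :=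
    (volume : Measure (EuclideanSpace ℝ (Fin d))).toSphere
  ((σ Set.univ)⁻¹ • σ).map Subtype.val

/-- The symmetric two-point estimator `(d / 2δ) (f (w + δ u) - f (w - δ u)) u`. -/
noncomputable def gradEstimate {d : ℕ} (δ : ℝ) (f : EuclideanSpace ℝ (Fin d) → ℝ)
    (w u : EuclideanSpace ℝ (Fin d)) : EuclideanSpace ℝ (Fin d) :=
  ((d : ℝ) / (2 * δ) * (f (w + δ • u) - f (w - δ • u))) • u

/-- `(θ, w)` is produced by `T` rounds of two-point bandit mirror descent on `W` with regularizer
`r`, step size `η` and exploration parameters `δ`, against the (possibly random and adaptive) losses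
`f`, with sampled directions `u`. Rounds are numbered `0, …, T - 1`, and the `σ`-algebra `ℱ t`
stands for everything that is known before the direction `u t` is sampled. -/
structure IsRun {d : ℕ} {Ω : Type*} [mΩ : MeasurableSpace Ω] (μ : Measure Ω)
    (ℱ : Filtration ℕ mΩ)
    (T : ℕ) (W : Set (EuclideanSpace ℝ (Fin d))) (r : EuclideanSpace ℝ (Fin d) → ℝ)
    (η : ℝ) (δ : ℕ → ℝ)
    (f : ℕ → Ω → EuclideanSpace ℝ (Fin d) → ℝ)
    (u θ w : ℕ → Ω → EuclideanSpace ℝ (Fin d)) : Prop where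
  /-- The adversary picks `f t` before `u t` is sampled. -/
  loss_adapted : ∀ t < T, ∀ x, Measurable[ℱ t] fun ω => f t ω x
  /-- `u t` is known after round `t`. -/
  dir_adapted : ∀ t < T, Measurable[ℱ (t + 1)] (u t)
  /-- `u t` is uniform on the Euclidean unit sphere. -/
  dir_law : ∀ t < T, μ.map (u t) = uniformSphere d
  /-- `u t` is fresh randomness. -/
  dir_indep : ∀ t < T, Indep (MeasurableSpace.comap (u t) inferInstance) (ℱ t) μ
  /-- `w t` is the maximizer over `W` of `⟨θ t, x⟩ - r x`. -/
  predict : ∀ t < T, ∀ ω,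
    w t ω ∈ W ∧ IsMaxOn (fun x => inner ℝ (θ t ω) x - r x) W (w t ω)
  init : ∀ ω, θ 0 ω = 0
  update : ∀ t < T, ∀ ω,
    θ (t + 1) ω = θ t ω - η • gradEstimate (δ t) (f t ω) (w t ω) (u t ω)

end TwoPointBandit

/-! Mirror descent run on linear losses `g t` has, path by path, regret at most `R² / η + (η / 2) ∑
‖g t‖_*²`. In expectation, two facts about the estimator turn this into the claim.

Bias. By symmetry the mean of the estimator is that of its one-sided version, which by the
divergence theorem is the gradient of the average of `f` over the ball of radius `δ` around `w`.
Convexity and the Lipschitz bound then show that linearized regret underestimates true regret by at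
most `2 δ G` (`sub_le_integral_uniformSphere`). As `f` need not be smooth, the divergence theorem is
replaced by integration by parts against a Lipschitz cutoff whose width tends to zero.

Variance. The estimator is `(d / 2δ) h(u) u` with `h` odd and `2δG`-Lipschitz. Such an `h` has
fourth moment of order `(δG)⁴ / d²` on the sphere (`integral_pow_four_uniformSphere_le`), so
Cauchy–Schwarz against `E ‖u‖_*⁴ ≤ p⁴` gives `E ‖g‖_*² ≲ d p² G²`, with one factor `d` instead of
`d²`. The moment bound comes from Gaussian space: the 1-homogeneous extension of `h` is Lipschitz,
and an odd Lipschitz function of a Gaussian vector is controlled by rotating `x` to `-x` through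
independent copies (`integral_pow_four_stdGaussian_le`).

With the stated `η` and `δ`, each of the three terms is of order `p G R √(dT)`. -/

namespace TwoPointBandit

/-! ### Uniform measure on the sphere and polar coordinates -/

section Sphere

variable {d : ℕ}

lemma integral_uniformSphere (k : EuclideanSpace ℝ (Fin d) → ℝ) :
    ∫ v, k v ∂uniformSphere d =
      ((volume : Measure (EuclideanSpace ℝ (Fin d))).toSphere.real Set.univ)⁻¹ *
        ∫ v : Metric.sphere (0 : EuclideanSpace ℝ (Fin d)) 1, k v
          ∂(volume : Measure (EuclideanSpace ℝ (Fin d))).toSphere := by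
  have hemb : MeasurableEmbedding
      (Subtype.val : Metric.sphere (0 : EuclideanSpace ℝ (Fin d)) 1 → _) :=
    .subtype_coe Metric.isClosed_sphere.measurableSet
  simp only [uniformSphere]
  rw [hemb.integral_map, integral_smul_measure, ENNReal.toReal_inv, smul_eq_mul]
  rfl

instance [NeZero d] : IsProbabilityMeasure (uniformSphere d) := by
  have : IsProbabilityMeasure
      ((((volume : Measure (EuclideanSpace ℝ (Fin d))).toSphere Set.univ)⁻¹ •
        (volume : Measure (EuclideanSpace ℝ (Fin d))).toSphere)) :=
    ⟨by
      rw [Measure.smul_apply, smul_eq_mul]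
      exact ENNReal.inv_mul_cancel
        (Measure.measure_univ_ne_zero.2 (Measure.toSphere_ne_zero _)) (measure_ne_top _ _)⟩
  exact Measure.isProbabilityMeasure_map (by fun_prop)

lemma ae_norm_uniformSphere : ∀ᵐ v ∂uniformSphere d, ‖v‖ = 1 := by
  simp only [uniformSphere]
  rw [ae_map_iff (by fun_prop) (measurableSet_eq_fun (by fun_prop) (by fun_prop))]
  exact .of_forall fun v => by simp

/-- Integration in polar coordinates of the product of a radial and an angular function. -/
lemma integral_radial_mul_angular [NeZero d] (q : ℝ → ℝ) (k : EuclideanSpace ℝ (Fin d) → ℝ) :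
    ∫ y : EuclideanSpace ℝ (Fin d), q ‖y‖ * k (‖y‖⁻¹ • y) =
      (∫ y : EuclideanSpace ℝ (Fin d), q ‖y‖) * ∫ v, k v ∂uniformSphere d := by
  set V : Measure (EuclideanSpace ℝ (Fin d)) := volume
  have key : ∀ k : EuclideanSpace ℝ (Fin d) → ℝ,
      ∫ y : EuclideanSpace ℝ (Fin d), q ‖y‖ * k (‖y‖⁻¹ • y) ∂V =
      (∫ v : Metric.sphere (0 : EuclideanSpace ℝ (Fin d)) 1, k v ∂V.toSphere) *
        ∫ t : Set.Ioi (0 : ℝ), q t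
          ∂Measure.volumeIoiPow (Module.finrank ℝ (EuclideanSpace ℝ (Fin d)) - 1) := by
    intro k
    have h := (Measure.measurePreserving_homeomorphUnitSphereProd V).integral_comp
      (homeomorphUnitSphereProd (EuclideanSpace ℝ (Fin d))).measurableEmbedding
      fun p => k p.1 * q p.2
    rw [integral_prod_mul (μ := V.toSphere) (fun p : Metric.sphere (0 : EuclideanSpace ℝ (Fin d)) 1 => k p)
      (fun t : Set.Ioi (0 : ℝ) => q t)] at h
    rw [← h]
    conv_lhs => rw [← restrict_compl_singleton (μ := V) 0,
      ← integral_subtype_comap (measurableSet_singleton _).compl]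
    refine integral_congr_ae (.of_forall fun y => ?_)
    simp [mul_comm]
  -- The case `k = 1` identifies the radial factor, so it need not be computed.
  have h1 := key fun _ => 1
  simp only [mul_one, integral_const, smul_eq_mul] at h1
  rw [key k, h1, integral_uniformSphere]
  have : V.toSphere.real Set.univ ≠ 0 := by
    rw [measureReal_ne_zero_iff]
    exact Measure.measure_univ_ne_zero.2 (Measure.toSphere_ne_zero _)
  change _ = _ * ((V.toSphere.real Set.univ)⁻¹ * ∫ v, k v ∂V.toSphere)
  field_simp

/-- Inherited from the reflection invariance of Lebesgue measure: any radial profile of nonzero mass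
will do, here the indicator of the unit ball. -/
lemma integral_uniformSphere_comp_neg [NeZero d] (k : EuclideanSpace ℝ (Fin d) → ℝ) :
    ∫ v, k (-v) ∂uniformSphere d = ∫ v, k v ∂uniformSphere d := by
  set q : ℝ → ℝ := Set.indicator (Set.Iio 1) 1
  have hq : ∫ y : EuclideanSpace ℝ (Fin d), q ‖y‖ ≠ 0 := by
    have : (fun y : EuclideanSpace ℝ (Fin d) => q ‖y‖) =
        Set.indicator (Metric.ball 0 1) 1 := by
      ext y
      simp [q, Set.indicator]
    rw [this, integral_indicator_one measurableSet_ball, measureReal_ne_zero_iff]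
    exact (Metric.measure_ball_pos _ _ one_pos).ne'
  have h1 := integral_radial_mul_angular q k
  have h2 := integral_radial_mul_angular q fun v => k (-v)
  have h3 := integral_neg_eq_self
    (fun y : EuclideanSpace ℝ (Fin d) => q ‖y‖ * k (‖y‖⁻¹ • y)) volume
  simp only [norm_neg, smul_neg] at h3
  rw [h2, h1] at h3
  exact mul_left_cancel₀ hq h3

end Sphere

/-! ### Density, polar factorization and moments of the standard Gaussian -/

section Gaussian

variable {d : ℕ}

/-- Both sides have the same characteristic function. Only the radial shape of the density is used
later, so the constant stays existential. -/
lemma stdGaussian_eq_withDensity (d : ℕ) : ∃ C : ℝ, 0 ≤ C ∧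
    stdGaussian (EuclideanSpace ℝ (Fin d)) =
      volume.withDensity fun x => ENNReal.ofReal (C * Real.exp (-(1 / 2) * ‖x‖ ^ 2)) := by
  have hint : Integrable fun x : EuclideanSpace ℝ (Fin d) => Real.exp (-(1 / 2) * ‖x‖ ^ 2) := by
    have := (GaussianFourier.integrable_cexp_neg_mul_sq_norm_add (b := 1 / 2) (by norm_num)
      0 (0 : EuclideanSpace ℝ (Fin d))).norm
    refine this.congr (.of_forall fun x => ?_)
    simp [Complex.norm_exp, ← Complex.ofReal_pow]
  refine ⟨(2 * Real.pi) ^ (-(d / 2 : ℝ)), by positivity, ?_⟩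
  set C : ℝ := (2 * Real.pi) ^ (-(d / 2 : ℝ)) with hC
  have hC0 : 0 ≤ C := by positivity
  have hfin : IsFiniteMeasure ((volume : Measure (EuclideanSpace ℝ (Fin d))).withDensity
      fun x => ENNReal.ofReal (C * Real.exp (-(1 / 2) * ‖x‖ ^ 2))) :=
    isFiniteMeasure_withDensity_ofReal (hint.const_mul C).2
  refine Measure.ext_of_charFun (funext fun t => ?_)
  rw [charFun_stdGaussian, charFun_apply,
    integral_withDensity_eq_integral_toReal_smul (by fun_prop) (by simp)]
  have h := GaussianFourier.integral_cexp_neg_mul_sq_norm_add (b := 1 / 2) (by norm_num)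
    Complex.I t
  have h2 : ∀ v : EuclideanSpace ℝ (Fin d),
      (ENNReal.ofReal (C * Real.exp (-(1 / 2) * ‖v‖ ^ 2))).toReal •
        Complex.exp ((inner ℝ v t : ℝ) * Complex.I) =
      (C : ℂ) * Complex.exp (-(1 / 2) * ‖v‖ ^ 2 + Complex.I * (inner ℝ t v : ℝ)) := by
    intro v
    rw [ENNReal.toReal_ofReal (by positivity), Complex.exp_add, real_inner_comm, Complex.real_smul]
    push_cast
    ring_nf
  simp_rw [h2]
  rw [integral_const_mul, h]
  have h3 : (C : ℂ) * ((Real.pi / (1 / 2) : ℂ) ^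
      (Module.finrank ℝ (EuclideanSpace ℝ (Fin d)) / 2 : ℂ)) = 1 := by
    have : ((Real.pi / (1 / 2) : ℂ) ^
      (Module.finrank ℝ (EuclideanSpace ℝ (Fin d)) / 2 : ℂ)) =
        (((2 * Real.pi) ^ (d / 2 : ℝ) : ℝ) : ℂ) := by
      rw [Complex.ofReal_cpow (by positivity)]
      simp [mul_comm]
    rw [this, ← Complex.ofReal_mul, hC, ← Real.rpow_add (by positivity)]
    simp
  rw [← mul_assoc, h3, one_mul]
  congr 1
  simp
  ring

lemma stdGaussian_absolutelyContinuous :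
    stdGaussian (EuclideanSpace ℝ (Fin d)) ≪ volume := by
  obtain ⟨C, -, h⟩ := stdGaussian_eq_withDensity d
  rw [h]
  exact withDensity_absolutelyContinuous _ _

lemma integral_stdGaussian_radial_mul_angular [NeZero d] (q : ℝ → ℝ)
    (k : EuclideanSpace ℝ (Fin d) → ℝ) :
    ∫ y, q ‖y‖ * k (‖y‖⁻¹ • y) ∂stdGaussian (EuclideanSpace ℝ (Fin d)) =
      (∫ y, q ‖y‖ ∂stdGaussian (EuclideanSpace ℝ (Fin d))) * ∫ v, k v ∂uniformSphere d := by
  obtain ⟨C, hC, h⟩ := stdGaussian_eq_withDensity d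
  rw [h, integral_withDensity_eq_integral_toReal_smul (by fun_prop) (by simp),
    integral_withDensity_eq_integral_toReal_smul (by fun_prop) (by simp)]
  have := integral_radial_mul_angular
    (fun t => (ENNReal.ofReal (C * Real.exp (-(1 / 2) * t ^ 2))).toReal * q t) k
  simpa only [smul_eq_mul, mul_assoc] using this

lemma integrable_norm_pow_stdGaussian (m : ℕ) :
    Integrable (fun x => ‖x‖ ^ m) (stdGaussian (EuclideanSpace ℝ (Fin d))) :=
  (IsGaussian.memLp_id (stdGaussian (EuclideanSpace ℝ (Fin d))) m
    (ENNReal.natCast_ne_top m)).integrable_norm_pow'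

/-- The fourth moment of the standard real Gaussian distribution. -/
noncomputable def gaussianFourthMoment : ℝ := ∫ x, x ^ 4 ∂gaussianReal 0 1

lemma gaussianFourthMoment_nonneg : 0 ≤ gaussianFourthMoment :=
  integral_nonneg fun x => by positivity

lemma integral_dual_pow_four_stdGaussian (L : StrongDual ℝ (EuclideanSpace ℝ (Fin d))) :
    ∫ y, L y ^ 4 ∂stdGaussian (EuclideanSpace ℝ (Fin d)) = ‖L‖ ^ 4 * gaussianFourthMoment := by
  have h1 : (stdGaussian (EuclideanSpace ℝ (Fin d))).map L =
      (gaussianReal 0 1).map (‖L‖ * ·) := by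
    rw [IsGaussian.map_eq_gaussianReal, gaussianReal_map_const_mul]
    have h2 := variance_dual_stdGaussian L
    congr 1
    · simp
    · rw [h2]; ext; simp
  have h2 := integral_map (μ := stdGaussian (EuclideanSpace ℝ (Fin d))) (φ := L)
    (by fun_prop) (f := fun x : ℝ => x ^ 4) (by fun_prop)
  rw [← h2, h1, integral_map (by fun_prop) (by fun_prop)]
  simp_rw [mul_pow]
  rw [integral_const_mul, gaussianFourthMoment]

lemma integral_norm_sq_stdGaussian :
    ∫ x, ‖x‖ ^ 2 ∂stdGaussian (EuclideanSpace ℝ (Fin d)) = d := by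
  have hi : ∀ i : Fin d, ∫ x : EuclideanSpace ℝ (Fin d), x i ^ 2 ∂stdGaussian _ = 1 := by
    intro i
    have h := variance_dual_stdGaussian (EuclideanSpace.proj (𝕜 := ℝ) i : StrongDual ℝ (EuclideanSpace ℝ (Fin d)))
    rw [variance_of_integral_eq_zero (by fun_prop) (integral_strongDual_stdGaussian _)] at h
    have h1 : ‖(EuclideanSpace.proj (𝕜 := ℝ) i : StrongDual ℝ (EuclideanSpace ℝ (Fin d)))‖ = 1 := by
      have h2 : (EuclideanSpace.proj (𝕜 := ℝ) i : StrongDual ℝ (EuclideanSpace ℝ (Fin d))) =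
          innerSL ℝ (EuclideanSpace.single i (1 : ℝ)) := by
        ext x; simp [EuclideanSpace.inner_single_left]
      rw [h2, innerSL_apply_norm]; simp
    simpa [h1] using h
  simp_rw [EuclideanSpace.real_norm_sq_eq]
  rw [integral_finsetSum]
  · simp [hi]
  · intro i _
    -- A non-integrable function has integral `0`, whereas this one has integral `1`.
    by_contra h
    have := hi i
    rw [integral_undef h] at this
    norm_num at this

/-- Nonnegativity of the variance of `‖x‖²`, whose mean is `d`. -/
lemma sq_le_integral_norm_pow_four_stdGaussian :
    (d : ℝ) ^ 2 ≤ ∫ x, ‖x‖ ^ 4 ∂stdGaussian (EuclideanSpace ℝ (Fin d)) := by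
  have h := integral_nonneg (μ := stdGaussian (EuclideanSpace ℝ (Fin d)))
    (f := fun x => (‖x‖ ^ 2 - d) ^ 2) fun x => by positivity
  have h2 : ∀ x : EuclideanSpace ℝ (Fin d),
      (‖x‖ ^ 2 - d) ^ 2 = (‖x‖ ^ 4 - 2 * d * ‖x‖ ^ 2) + (d : ℝ) ^ 2 := fun x => by ring
  simp_rw [h2] at h
  rw [integral_add, integral_sub, integral_const_mul, integral_norm_sq_stdGaussian] at h
  · simp at h
    nlinarith
  · exact integrable_norm_pow_stdGaussian 4
  · exact (integrable_norm_pow_stdGaussian 2).const_mul _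
  · exact (integrable_norm_pow_stdGaussian 4).sub ((integrable_norm_pow_stdGaussian 2).const_mul _)
  · exact integrable_const _

end Gaussian

/-! ### Fourth moments of odd Lipschitz functions in Gaussian space -/

section Concentration

open Filter Topology
open scoped NNReal

variable {d : ℕ}

/-- At a point of differentiability `x` of `g`, the curve `s ↦ g (cos s • x + sin s • y)` has
derivative `Dg(x) y` at `0`. Rademacher's theorem makes almost every `x` such a point, and the
Lipschitz bound dominates the difference quotients. -/
lemma integral_lipschitz_increment_tendsto {K : ℝ≥0} {g : EuclideanSpace ℝ (Fin d) → ℝ}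
    (hg : LipschitzWith K g) :
    Tendsto (fun n : ℕ => ∫ p, ((n : ℝ) * (g (Real.cos (Real.pi / n) • p.1 +
        Real.sin (Real.pi / n) • p.2) - g p.1)) ^ 4
      ∂(stdGaussian (EuclideanSpace ℝ (Fin d))).prod (stdGaussian (EuclideanSpace ℝ (Fin d))))
      atTop (𝓝 (∫ p, (Real.pi * fderiv ℝ g p.1 p.2) ^ 4
      ∂(stdGaussian (EuclideanSpace ℝ (Fin d))).prod
        (stdGaussian (EuclideanSpace ℝ (Fin d))))) := by
  set γ := stdGaussian (EuclideanSpace ℝ (Fin d)) with hγ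
  refine tendsto_integral_of_dominated_convergence
    (fun p => (2 * Real.pi * K) ^ 4 * ‖p‖ ^ 4) (fun n => ?_) ?_ (fun n => ?_) ?_
  · have := hg.continuous
    exact Continuous.aestronglyMeasurable (by fun_prop)
  · exact ((IsGaussian.memLp_id (γ.prod γ) (4 : ℕ)
      (ENNReal.natCast_ne_top 4)).integrable_norm_pow').const_mul _
  · refine .of_forall fun p => ?_
    rcases n.eq_zero_or_pos with rfl | hn
    · simp; positivity
    have hn' : (0 : ℝ) < n := by exact_mod_cast hn
    rw [norm_pow, ← mul_pow]
    refine pow_le_pow_left₀ (norm_nonneg _) ?_ 4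
    rw [norm_mul, Real.norm_natCast]
    set s := Real.pi / n with hs
    have hs0 : 0 ≤ s := by positivity
    have hcos : |Real.cos s - 1| ≤ s := by
      have := Real.abs_cos_sub_cos_le s 0
      simpa [abs_of_nonneg hs0] using this
    have hsin : |Real.sin s| ≤ s := by
      simpa [abs_of_nonneg hs0] using Real.abs_sin_le_abs (x := s)
    have h1 : ‖Real.cos s • p.1 + Real.sin s • p.2 - p.1‖ ≤ s * ‖p‖ + s * ‖p‖ := by
      have : Real.cos s • p.1 + Real.sin s • p.2 - p.1 =
          (Real.cos s - 1) • p.1 + Real.sin s • p.2 := by module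
      rw [this]
      refine (norm_add_le _ _).trans (add_le_add ?_ ?_)
      · rw [norm_smul]
        exact mul_le_mul hcos (norm_fst_le p) (norm_nonneg _) hs0
      · rw [norm_smul]
        exact mul_le_mul hsin (norm_snd_le p) (norm_nonneg _) hs0
    have h2 := hg.norm_sub_le (Real.cos s • p.1 + Real.sin s • p.2) p.1
    calc (n : ℝ) * ‖g (Real.cos s • p.1 + Real.sin s • p.2) - g p.1‖
        ≤ n * (K * (s * ‖p‖ + s * ‖p‖)) := by gcongr; exact h2.trans (by gcongr)
      _ = 2 * (n * s) * K * ‖p‖ := by ring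
      _ = 2 * Real.pi * K * ‖p‖ := by rw [hs, mul_div_cancel₀ _ hn'.ne']
  · have hae : ∀ᵐ x ∂γ, DifferentiableAt ℝ g x :=
      stdGaussian_absolutelyContinuous hg.ae_differentiableAt
    filter_upwards [Measure.quasiMeasurePreserving_fst.ae hae] with p hp
    refine Tendsto.pow ?_ 4
    have hder : HasDerivAt (fun s : ℝ => g (Real.cos s • p.1 + Real.sin s • p.2))
        (fderiv ℝ g p.1 p.2) 0 := by
      have hc : HasDerivAt (fun s : ℝ => Real.cos s • p.1 + Real.sin s • p.2) p.2 0 := by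
        have := ((Real.hasDerivAt_cos 0).smul_const p.1).add
          ((Real.hasDerivAt_sin 0).smul_const p.2)
        simp only [Real.sin_zero, neg_zero, zero_smul, Real.cos_zero, one_smul, zero_add] at this
        exact this
      have hp' : HasFDerivAt g (fderiv ℝ g p.1)
          (Real.cos 0 • p.1 + Real.sin 0 • p.2) := by simpa using hp.hasFDerivAt
      exact hp'.comp_hasDerivAt 0 hc
    have hlim : Tendsto (fun n : ℕ => Real.pi / n) atTop (𝓝[≠] (0 : ℝ)) := by
      refine tendsto_nhdsWithin_iff.2 ⟨tendsto_const_div_atTop_nhds_zero_nat _, ?_⟩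
      filter_upwards [eventually_gt_atTop 0] with n hn
      have : (0 : ℝ) < n := by exact_mod_cast hn
      have := Real.pi_pos
      exact (by positivity : Real.pi / (n : ℝ) ≠ 0)
    have := ((hasDerivAt_iff_tendsto_slope.1 hder).comp hlim).const_mul Real.pi
    refine this.congr' ?_
    filter_upwards [eventually_gt_atTop 0] with n hn
    have : (0 : ℝ) < n := by exact_mod_cast hn
    simp only [Function.comp, slope_def_field, Real.cos_zero, Real.sin_zero, one_smul, zero_smul,
      add_zero, sub_zero]
    have := Real.pi_pos
    field_simp

/-- For fixed `x`, `Dg(x) y` is a centred real Gaussian of standard deviation `‖Dg(x)‖ ≤ K`; then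
Fubini. -/
lemma integral_fderiv_pow_four_le {K : ℝ≥0} {g : EuclideanSpace ℝ (Fin d) → ℝ}
    (hg : LipschitzWith K g) :
    ∫ p, (Real.pi * fderiv ℝ g p.1 p.2) ^ 4
      ∂(stdGaussian (EuclideanSpace ℝ (Fin d))).prod (stdGaussian (EuclideanSpace ℝ (Fin d))) ≤
      Real.pi ^ 4 * gaussianFourthMoment * K ^ 4 := by
  set γ := stdGaussian (EuclideanSpace ℝ (Fin d)) with hγ
  have hmeas : Measurable fun p : EuclideanSpace ℝ (Fin d) × EuclideanSpace ℝ (Fin d) =>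
      fderiv ℝ g p.1 p.2 :=
    (isBoundedBilinearMap_apply (𝕜 := ℝ) (E := EuclideanSpace ℝ (Fin d))
      (F := ℝ)).continuous.measurable.comp
      (((measurable_fderiv ℝ g).comp measurable_fst).prodMk measurable_snd)
  have hbd : ∀ x, ‖fderiv ℝ g x‖ ≤ K := fun x => norm_fderiv_le_of_lipschitz ℝ hg
  have hint : Integrable (fun p : EuclideanSpace ℝ (Fin d) × EuclideanSpace ℝ (Fin d) =>
      (Real.pi * fderiv ℝ g p.1 p.2) ^ 4) (γ.prod γ) := by
    refine Integrable.mono' (((IsGaussian.memLp_id (γ.prod γ) (4 : ℕ)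
      (ENNReal.natCast_ne_top 4)).integrable_norm_pow').const_mul ((Real.pi * K) ^ 4))
      ((hmeas.const_mul _).pow_const 4).aestronglyMeasurable (.of_forall fun p => ?_)
    rw [norm_pow, ← mul_pow]
    refine pow_le_pow_left₀ (norm_nonneg _) ?_ 4
    rw [norm_mul, Real.norm_of_nonneg Real.pi_pos.le, mul_assoc]
    refine mul_le_mul_of_nonneg_left ?_ Real.pi_pos.le
    exact ((fderiv ℝ g p.1).le_opNorm p.2).trans
      (mul_le_mul (hbd _) (norm_snd_le p) (norm_nonneg _) K.2)
  rw [integral_prod _ hint]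
  have h1 : ∀ x, ∫ y, (Real.pi * fderiv ℝ g x y) ^ 4 ∂γ ≤
      Real.pi ^ 4 * gaussianFourthMoment * K ^ 4 := by
    intro x
    simp_rw [mul_pow]
    rw [integral_const_mul, integral_dual_pow_four_stdGaussian]
    have := pow_le_pow_left₀ (norm_nonneg _) (hbd x) 4
    have h0 := gaussianFourthMoment_nonneg
    calc Real.pi ^ 4 * (‖fderiv ℝ g x‖ ^ 4 * gaussianFourthMoment)
        ≤ Real.pi ^ 4 * (K ^ 4 * gaussianFourthMoment) := by gcongr
      _ = _ := by ring
  have := integral_mono (μ := γ) hint.integral_prod_left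
    (integrable_const (Real.pi ^ 4 * gaussianFourthMoment * (K : ℝ) ^ 4)) h1
  simpa using this

lemma integrable_lipschitz_diff_pow_four {K : ℝ≥0} {g : EuclideanSpace ℝ (Fin d) → ℝ}
    (hg : LipschitzWith K g)
    (A B : EuclideanSpace ℝ (Fin d) × EuclideanSpace ℝ (Fin d) →L[ℝ] EuclideanSpace ℝ (Fin d)) :
    Integrable (fun p => (g (A p) - g (B p)) ^ 4)
      ((stdGaussian (EuclideanSpace ℝ (Fin d))).prod
        (stdGaussian (EuclideanSpace ℝ (Fin d)))) := by
  set γ := stdGaussian (EuclideanSpace ℝ (Fin d)) with hγ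
  have hc := hg.continuous
  refine Integrable.mono' (((IsGaussian.memLp_id (γ.prod γ) (4 : ℕ)
    (ENNReal.natCast_ne_top 4)).integrable_norm_pow').const_mul ((K * ‖A - B‖) ^ 4))
    (Continuous.aestronglyMeasurable (by fun_prop)) (.of_forall fun p => ?_)
  rw [norm_pow, ← mul_pow]
  refine pow_le_pow_left₀ (norm_nonneg _) ?_ 4
  refine (hg.norm_sub_le _ _).trans ?_
  rw [mul_assoc]
  exact mul_le_mul_of_nonneg_left ((A - B).le_opNorm p) K.2

/-- An odd `K`-Lipschitz function of a standard Gaussian vector has fourth moment of order `K ^ 4`,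
whatever the dimension. -/
lemma integral_pow_four_stdGaussian_le {K : ℝ≥0} {g : EuclideanSpace ℝ (Fin d) → ℝ}
    (hg : LipschitzWith K g) (hodd : ∀ x, g (-x) = -g x) :
    16 * ∫ x, g x ^ 4 ∂stdGaussian (EuclideanSpace ℝ (Fin d)) ≤
      Real.pi ^ 4 * gaussianFourthMoment * K ^ 4 := by
  set γ := stdGaussian (EuclideanSpace ℝ (Fin d)) with hγ
  refine (ge_of_tendsto (integral_lipschitz_increment_tendsto hg) ?_).trans
    (integral_fderiv_pow_four_le hg)
  filter_upwards [eventually_gt_atTop 0] with n hn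
  have hn' : (0 : ℝ) < n := by exact_mod_cast hn
  -- `z k` is the point at angle `kπ/n` on the arc from `x` through `y` to `-x`; successive
  -- increments of `g` along it are identically distributed, by rotation invariance.
  let z : ℕ → EuclideanSpace ℝ (Fin d) × EuclideanSpace ℝ (Fin d) →L[ℝ] EuclideanSpace ℝ (Fin d) :=
    fun k => (ContinuousLinearMap.fst ℝ _ _).comp
      (ContinuousLinearMap.rotation (k * (Real.pi / n)))
  have hz : ∀ k p, z k p = Real.cos (k * (Real.pi / n)) • p.1 +
      Real.sin (k * (Real.pi / n)) • p.2 := fun k p => rfl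
  have hz0 : ∀ p, z 0 p = p.1 := fun p => by simp [hz]
  have hzn : ∀ p, z n p = -p.1 := fun p => by
    rw [hz, mul_div_cancel₀ _ hn'.ne']; simp
  have hzs : ∀ k p, z (k + 1) p = z 1 (ContinuousLinearMap.rotation (k * (Real.pi / n)) p) := by
    intro k p
    rw [hz, hz, ContinuousLinearMap.rotation_apply]
    have : ((k + 1 : ℕ) : ℝ) * (Real.pi / n) = (1 : ℕ) * (Real.pi / n) + k * (Real.pi / n) := by
      push_cast; ring
    rw [this, Real.cos_add, Real.sin_add]
    module
  have hzk : ∀ k p, z k p = z 0 (ContinuousLinearMap.rotation (k * (Real.pi / n)) p) := by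
    intro k p
    rw [hz0]; rfl
  have hinv : ∀ k, ∫ p, (g (z (k + 1) p) - g (z k p)) ^ 4 ∂γ.prod γ =
      ∫ p, (g (z 1 p) - g (z 0 p)) ^ 4 ∂γ.prod γ := by
    intro k
    have hrot := IsGaussian.map_rotation_eq_self (μ := γ) (by simpa using integral_id_stdGaussian)
      (k * (Real.pi / n))
    have hc := hg.continuous
    conv_rhs => rw [← hrot]
    rw [integral_map (by fun_prop) (Continuous.aestronglyMeasurable (by fun_prop))]
    simp only [hzs k, ← hzk k]
  -- The increments telescope to `g(-x) - g(x) = -2 g(x)`, whence `16 = 2⁴`; the power mean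
  -- inequality supplies `n³`.
  have hpt : ∀ p : EuclideanSpace ℝ (Fin d) × EuclideanSpace ℝ (Fin d),
      16 * g p.1 ^ 4 ≤ n ^ 3 * ∑ k ∈ Finset.range n, (g (z (k + 1) p) - g (z k p)) ^ 4 := by
    intro p
    have h := Finset.sum_range_sub (fun k => g (z k p)) n
    simp only [hz0, hzn, hodd] at h
    have h2 := pow_sum_le_card_mul_sum_pow (s := Finset.range n)
      (f := fun k => |g (z (k + 1) p) - g (z k p)|) (fun _ _ => abs_nonneg _) 3
    have h3 := pow_le_pow_left₀ (abs_nonneg _)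
      (Finset.abs_sum_le_sum_abs (fun k => g (z (k + 1) p) - g (z k p)) (Finset.range n)) 4
    rw [h] at h3
    simp only [Finset.card_range, Nat.reduceAdd, Even.pow_abs (n := 4) ⟨2, rfl⟩] at h2 h3
    linarith
  have hint : ∀ k, Integrable (fun p => (g (z (k + 1) p) - g (z k p)) ^ 4) (γ.prod γ) :=
    fun k => integrable_lipschitz_diff_pow_four hg _ _
  calc 16 * ∫ x, g x ^ 4 ∂γ = ∫ p, 16 * g p.1 ^ 4 ∂γ.prod γ := by
        rw [← integral_const_mul, integral_fun_fst (μ := γ) (ν := γ) (fun x => 16 * g x ^ 4)]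
        simp
    _ ≤ ∫ p, n ^ 3 * ∑ k ∈ Finset.range n, (g (z (k + 1) p) - g (z k p)) ^ 4 ∂γ.prod γ :=
        integral_mono_of_nonneg (.of_forall fun p => by positivity)
          ((integrable_finsetSum _ fun k _ => hint k).const_mul _) (.of_forall hpt)
    _ = n ^ 3 * (n * ∫ p, (g (z 1 p) - g (z 0 p)) ^ 4 ∂γ.prod γ) := by
        rw [integral_const_mul, integral_finsetSum _ fun k _ => hint k]
        simp [hinv]
    _ = n ^ 4 * ∫ p, (g (z 1 p) - g (z 0 p)) ^ 4 ∂γ.prod γ := by ring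
    _ = _ := by
        rw [← integral_const_mul]
        simp only [← mul_pow, hz0, hz, Nat.cast_one, one_mul]
        rfl

end Concentration

/-! ### Transfer of the moment bound to the sphere -/

section SphereConcentration

open scoped NNReal

variable {d : ℕ}

/-- Changing the radius costs `L`, as `|h| ≤ L` on the unit ball; changing the direction costs `2L`,
as `‖y‖ ‖a - b‖ ≤ 2 ‖x - y‖` for the directions `a`, `b` of `x`, `y`. -/
lemma lipschitzWith_norm_mul_comp_direction {L : ℝ≥0} {h : EuclideanSpace ℝ (Fin d) → ℝ}
    (hL : LipschitzWith L h) (h0 : h 0 = 0) :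
    LipschitzWith (3 * L) fun x => ‖x‖ * h (‖x‖⁻¹ • x) := by
  have hself : ∀ x : EuclideanSpace ℝ (Fin d), ‖x‖ • ‖x‖⁻¹ • x = x := by
    intro x
    rcases eq_or_ne x 0 with rfl | hx
    · simp
    · rw [smul_smul, mul_inv_cancel₀ (norm_ne_zero_iff.2 hx), one_smul]
  have hdir : ∀ x : EuclideanSpace ℝ (Fin d), ‖‖x‖⁻¹ • x‖ ≤ 1 := by
    intro x
    rw [norm_smul, norm_inv, norm_norm]
    exact inv_mul_le_one
  refine LipschitzWith.of_dist_le_mul fun x y => ?_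
  have hab := abs_norm_sub_norm_le x y
  set a := ‖x‖⁻¹ • x
  set b := ‖y‖⁻¹ • y
  have h1 : |h a| ≤ L := by
    have := hL.norm_sub_le a 0
    rw [h0, sub_zero, sub_zero, Real.norm_eq_abs] at this
    exact this.trans (mul_le_of_le_one_right L.2 (hdir x))
  have h2 : ‖y‖ * |h a - h b| ≤ L * (2 * ‖x - y‖) := by
    have h3 : ‖y‖ * ‖a - b‖ ≤ 2 * ‖x - y‖ := by
      calc ‖y‖ * ‖a - b‖ = ‖‖y‖ • (a - b)‖ := by rw [norm_smul, norm_norm]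
        _ = ‖-((‖x‖ - ‖y‖) • a) + (x - y)‖ := by
          congr 1
          have hx : x = ‖x‖ • a := (hself x).symm
          have hy : y = ‖y‖ • b := (hself y).symm
          generalize ‖x‖ = α at hx ⊢
          generalize ‖y‖ = β at hy ⊢
          clear_value a b
          rw [hx, hy]
          module
        _ ≤ ‖(‖x‖ - ‖y‖) • a‖ + ‖x - y‖ := by
          refine (norm_add_le _ _).trans ?_
          rw [norm_neg]
        _ ≤ ‖x - y‖ * 1 + ‖x - y‖ := by
          rw [norm_smul, Real.norm_eq_abs]
          gcongr
          exact hdir x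
        _ = 2 * ‖x - y‖ := by ring
    calc ‖y‖ * |h a - h b| ≤ ‖y‖ * (L * ‖a - b‖) := by
          gcongr; exact hL.norm_sub_le a b
      _ = L * (‖y‖ * ‖a - b‖) := by ring
      _ ≤ _ := by gcongr
  rw [Real.dist_eq, dist_eq_norm]
  calc |‖x‖ * h a - ‖y‖ * h b| = |(‖x‖ - ‖y‖) * h a + ‖y‖ * (h a - h b)| := by ring_nf
    _ ≤ |‖x‖ - ‖y‖| * |h a| + ‖y‖ * |h a - h b| := by
      refine (abs_add_le _ _).trans ?_
      rw [abs_mul, abs_mul, abs_of_nonneg (norm_nonneg y)]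
    _ ≤ ‖x - y‖ * L + L * (2 * ‖x - y‖) := by gcongr
    _ = ((3 * L : ℝ≥0) : ℝ) * ‖x - y‖ := by push_cast; ring

/-- The constant in the fourth moment bound for odd Lipschitz functions on the sphere. -/
noncomputable def sphereConst : ℝ := 81 / 16 * Real.pi ^ 4 * gaussianFourthMoment

lemma sphereConst_nonneg : 0 ≤ sphereConst :=
  mul_nonneg (by positivity) gaussianFourthMoment_nonneg

/-- An odd `L`-Lipschitz function on the unit sphere of `ℝ^d` has fourth moment of order
`L ^ 4 / d ^ 2`. -/
lemma integral_pow_four_uniformSphere_le [NeZero d] {L : ℝ≥0}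
    {h : EuclideanSpace ℝ (Fin d) → ℝ} (hL : LipschitzWith L h) (hodd : ∀ x, h (-x) = -h x) :
    (d : ℝ) ^ 2 * ∫ v, h v ^ 4 ∂uniformSphere d ≤ sphereConst * L ^ 4 := by
  have h0 : h 0 = 0 := by
    have := hodd 0
    rw [neg_zero] at this
    linarith
  have h1 := integral_pow_four_stdGaussian_le (lipschitzWith_norm_mul_comp_direction hL h0)
    (fun x => by simp [hodd])
  simp_rw [mul_pow] at h1
  -- Norm and direction decouple, so the Gaussian moment is `E ‖x‖⁴` times the spherical one.
  rw [integral_stdGaussian_radial_mul_angular (fun t => t ^ 4) fun x => h x ^ 4] at h1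
  have h2 := mul_le_mul_of_nonneg_right (sq_le_integral_norm_pow_four_stdGaussian (d := d))
    (integral_nonneg (μ := uniformSphere d) (f := fun v => h v ^ 4) fun v => by positivity)
  rw [sphereConst]
  push_cast at h1
  linarith

end SphereConcentration

/-! ### The dual norm -/

section DualNorm

variable {d : ℕ} {N : Seminorm ℝ (EuclideanSpace ℝ (Fin d))}

lemma continuous_seminorm (N : Seminorm ℝ (EuclideanSpace ℝ (Fin d))) : Continuous N :=
  continuousOn_univ.1 (N.convexOn.continuousOn isOpen_univ)

lemma exists_pos_mul_norm_le (hN : ∀ x, N x = 0 → x = 0) :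
    ∃ c : ℝ, 0 < c ∧ ∀ x, c * ‖x‖ ≤ N x := by
  -- The sphere is empty exactly when `d = 0`.
  rcases isEmpty_or_nonempty (Metric.sphere (0 : EuclideanSpace ℝ (Fin d)) 1) with he | hne
  · refine ⟨1, one_pos, fun x => ?_⟩
    rcases eq_or_ne x 0 with rfl | hx
    · simp
    · refine (he.false ⟨‖x‖⁻¹ • x, ?_⟩).elim
      simp [norm_smul, hx]
  · obtain ⟨x₀, hx₀, hmin⟩ := (isCompact_sphere (0 : EuclideanSpace ℝ (Fin d)) 1).exists_isMinOn
      (Set.nonempty_coe_sort.1 hne) (continuous_seminorm N).continuousOn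
    have hne0 : x₀ ≠ 0 := by
      rintro rfl
      simp at hx₀
    refine ⟨N x₀, (apply_nonneg N x₀).lt_of_ne' fun h => hne0 (hN _ h), fun x => ?_⟩
    rcases eq_or_ne x 0 with rfl | hx
    · simp
    · have h1 : N x₀ ≤ N (‖x‖⁻¹ • x) := hmin (by simp [norm_smul, hx])
      rw [map_smul_eq_mul, norm_inv, norm_norm] at h1
      have : 0 < ‖x‖ := norm_pos_iff.2 hx
      rw [inv_mul_eq_div, le_div_iff₀ this] at h1
      exact h1

/-- Guards against the default value `0` of `sSup` on unbounded sets; definiteness of `N` is what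
excludes it. -/
lemma bddAbove_dualNorm_set (hN : ∀ x, N x = 0 → x = 0) (θ : EuclideanSpace ℝ (Fin d)) :
    BddAbove {a : ℝ | ∃ w : EuclideanSpace ℝ (Fin d), N w ≤ 1 ∧ a = inner ℝ θ w} := by
  obtain ⟨c, hc, h⟩ := exists_pos_mul_norm_le hN
  refine ⟨‖θ‖ * c⁻¹, ?_⟩
  rintro _ ⟨w, hw, rfl⟩
  refine (real_inner_le_norm θ w).trans (mul_le_mul_of_nonneg_left ?_ (norm_nonneg θ))
  rw [← one_div, le_div_iff₀ hc, mul_comm]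
  exact (h w).trans hw

lemma dualNorm_le {θ : EuclideanSpace ℝ (Fin d)} {b : ℝ}
    (h : ∀ w, N w ≤ 1 → inner ℝ θ w ≤ b) : dualNorm N θ ≤ b := by
  refine csSup_le ⟨0, 0, by simp, by simp⟩ ?_
  rintro _ ⟨w, hw, rfl⟩
  exact h w hw

lemma inner_le_dualNorm_of_le_one (hN : ∀ x, N x = 0 → x = 0) (θ : EuclideanSpace ℝ (Fin d))
    {w : EuclideanSpace ℝ (Fin d)} (hw : N w ≤ 1) : inner ℝ θ w ≤ dualNorm N θ :=
  le_csSup (bddAbove_dualNorm_set hN θ) ⟨w, hw, rfl⟩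

lemma dualNorm_nonneg (hN : ∀ x, N x = 0 → x = 0) (θ : EuclideanSpace ℝ (Fin d)) :
    0 ≤ dualNorm N θ := by
  simpa using inner_le_dualNorm_of_le_one hN θ (w := 0) (by simp)

lemma inner_le_dualNorm_mul (hN : ∀ x, N x = 0 → x = 0) (θ w : EuclideanSpace ℝ (Fin d)) :
    inner ℝ θ w ≤ dualNorm N θ * N w := by
  rcases eq_or_ne w 0 with rfl | hw
  · simp
  · have hpos : 0 < N w := (apply_nonneg N w).lt_of_ne' fun h => hw (hN _ h)
    have h1 := inner_le_dualNorm_of_le_one hN θ (w := (N w)⁻¹ • w) (by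
      rw [map_smul_eq_mul, norm_inv, Real.norm_of_nonneg hpos.le, inv_mul_cancel₀ hpos.ne'])
    rw [inner_smul_right, inv_mul_eq_div, div_le_iff₀ hpos] at h1
    exact h1

lemma dualNorm_smul_le (hN : ∀ x, N x = 0 → x = 0) (a : ℝ) (θ : EuclideanSpace ℝ (Fin d)) :
    dualNorm N (a • θ) ≤ |a| * dualNorm N θ := by
  refine dualNorm_le fun w hw => ?_
  have h1 : inner ℝ (a • θ) w = inner ℝ θ (a • w) := by
    rw [real_inner_smul_left, real_inner_smul_right]
  rw [h1]
  refine (inner_le_dualNorm_mul hN θ _).trans ?_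
  rw [map_smul_eq_mul, Real.norm_eq_abs, mul_comm]
  exact mul_le_mul_of_nonneg_right (mul_le_of_le_one_right (abs_nonneg a) hw)
    (dualNorm_nonneg hN θ)

lemma dualNorm_pos (hN : ∀ x, N x = 0 → x = 0) {θ : EuclideanSpace ℝ (Fin d)} (hθ : θ ≠ 0) :
    0 < dualNorm N θ := by
  refine (dualNorm_nonneg hN θ).lt_of_ne' fun h => hθ ?_
  have := inner_le_dualNorm_mul hN θ θ
  rw [h, zero_mul] at this
  exact real_inner_self_nonpos.1 this

lemma exists_dualNorm_le_mul_norm (hN : ∀ x, N x = 0 → x = 0) :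
    ∃ c : ℝ, 0 < c ∧ ∀ θ, dualNorm N θ ≤ c * ‖θ‖ := by
  obtain ⟨c, hc, h⟩ := exists_pos_mul_norm_le hN
  refine ⟨c⁻¹, inv_pos.2 hc, fun θ => dualNorm_le fun w hw => ?_⟩
  rw [mul_comm]
  refine (real_inner_le_norm θ w).trans (mul_le_mul_of_nonneg_left ?_ (norm_nonneg θ))
  rw [← one_div, le_div_iff₀ hc, mul_comm]
  exact (h w).trans hw

lemma continuous_dualNorm (hN : ∀ x, N x = 0 → x = 0) : Continuous (dualNorm N) := by
  obtain ⟨c, hc, h⟩ := exists_dualNorm_le_mul_norm hN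
  have hsub : ∀ θ θ' : EuclideanSpace ℝ (Fin d),
      dualNorm N θ - dualNorm N θ' ≤ c * ‖θ - θ'‖ := by
    intro θ θ'
    rw [sub_le_iff_le_add]
    refine dualNorm_le fun w hw => ?_
    have h1 : inner ℝ θ w = inner ℝ (θ - θ') w + inner ℝ θ' w := by
      rw [← inner_add_left, sub_add_cancel]
    rw [h1]
    exact add_le_add ((inner_le_dualNorm_of_le_one hN _ hw).trans (h _))
      (inner_le_dualNorm_of_le_one hN _ hw)
  refine (LipschitzWith.of_dist_le_mul (K := ⟨c, hc.le⟩) fun θ θ' => ?_).continuous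
  rw [Real.dist_eq, dist_eq_norm]
  refine abs_sub_le_iff.2 ⟨hsub θ θ', ?_⟩
  rw [norm_sub_rev]
  exact hsub θ' θ

lemma integrable_of_bdd_on_sphere [NeZero d] {k : EuclideanSpace ℝ (Fin d) → ℝ}
    (hk : Measurable k) {B : ℝ} (hB : ∀ v, ‖v‖ = 1 → |k v| ≤ B) :
    Integrable k (uniformSphere d) := by
  refine Integrable.of_bound hk.aestronglyMeasurable B ?_
  filter_upwards [ae_norm_uniformSphere] with v hv using hB v hv

lemma integrable_dualNorm_pow [NeZero d] (hN : ∀ x, N x = 0 → x = 0) (m : ℕ) :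
    Integrable (fun v => dualNorm N v ^ m) (uniformSphere d) := by
  obtain ⟨c, hc, h⟩ := exists_dualNorm_le_mul_norm hN
  refine integrable_of_bdd_on_sphere ((continuous_dualNorm hN).measurable.pow_const m)
    (B := c ^ m) fun v hv => ?_
  rw [abs_pow, abs_of_nonneg (dualNorm_nonneg hN v)]
  refine pow_le_pow_left₀ (dualNorm_nonneg hN v) ?_ m
  simpa [hv] using h v

/-- Forces `p > 0` in the main theorem, where positivity of `p` is not assumed. -/
lemma integral_dualNorm_pow_four_pos [NeZero d] (hN : ∀ x, N x = 0 → x = 0) :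
    0 < ∫ v, dualNorm N v ^ 4 ∂uniformSphere d := by
  refine (integral_nonneg fun v => by positivity).lt_of_ne' fun h => ?_
  rw [integral_eq_zero_iff_of_nonneg (fun v => by positivity) (integrable_dualNorm_pow hN 4)] at h
  obtain ⟨v, hv, hv'⟩ := (h.and ae_norm_uniformSphere).exists
  have hv0 : v ≠ 0 := by
    rintro rfl
    simp at hv'
  exact (pow_pos (dualNorm_pos hN hv0) 4).ne' hv

end DualNorm

/-! ### A divergence inequality for convex Lipschitz functions on the ball -/

section Flux

open Filter Topology
open scoped NNReal

variable {d : ℕ}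

/-- The radial cutoff equal to `1` on the unit ball, vanishing outside the ball of radius `1 + ε`,
and affine in the norm in between. -/
noncomputable def radialCutoff (ε : ℝ) (x : EuclideanSpace ℝ (Fin d)) : ℝ :=
  max 0 (min 1 ((1 + ε - ‖x‖) / ε))

lemma radialCutoff_nonneg (ε : ℝ) (x : EuclideanSpace ℝ (Fin d)) : 0 ≤ radialCutoff ε x :=
  le_max_left _ _

lemma radialCutoff_le_one (ε : ℝ) (x : EuclideanSpace ℝ (Fin d)) : radialCutoff ε x ≤ 1 :=
  max_le zero_le_one (min_le_left _ _)

lemma radialCutoff_of_le_one {ε : ℝ} (hε : 0 < ε) {x : EuclideanSpace ℝ (Fin d)} (hx : ‖x‖ ≤ 1) :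
    radialCutoff ε x = 1 := by
  rw [radialCutoff, min_eq_left, max_eq_right zero_le_one]
  rw [le_div_iff₀ hε]
  linarith

lemma radialCutoff_of_ge {ε : ℝ} (hε : 0 < ε) {x : EuclideanSpace ℝ (Fin d)}
    (hx : 1 + ε ≤ ‖x‖) : radialCutoff ε x = 0 := by
  rw [radialCutoff, max_eq_left]
  exact (min_le_right _ _).trans (div_nonpos_of_nonpos_of_nonneg (by linarith) hε.le)

lemma radialCutoff_of_mem_shell {ε : ℝ} (hε : 0 < ε) {x : EuclideanSpace ℝ (Fin d)}
    (h1 : 1 ≤ ‖x‖) (h2 : ‖x‖ ≤ 1 + ε) : radialCutoff ε x = (1 + ε - ‖x‖) / ε := by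
  rw [radialCutoff, min_eq_right, max_eq_right]
  · exact div_nonneg (by linarith) hε.le
  · rw [div_le_one hε]
    linarith

lemma lipschitzWith_radialCutoff {ε : ℝ} (hε : 0 < ε) :
    LipschitzWith (Real.toNNReal ε⁻¹)
      (radialCutoff ε : EuclideanSpace ℝ (Fin d) → ℝ) := by
  have h : LipschitzWith (Real.toNNReal ε⁻¹)
      fun x : EuclideanSpace ℝ (Fin d) => (1 + ε - ‖x‖) / ε := by
    refine LipschitzWith.of_dist_le_mul fun x y => ?_
    rw [Real.dist_eq, dist_eq_norm, Real.coe_toNNReal _ (by positivity), ← sub_div, abs_div,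
      abs_of_pos hε, inv_mul_eq_div]
    gcongr
    rw [sub_sub_sub_cancel_left, norm_sub_rev]
    exact abs_norm_sub_norm_le _ _
  exact (h.const_min 1).const_max 0

lemma hasCompactSupport_radialCutoff {ε : ℝ} (hε : 0 < ε) :
    HasCompactSupport (radialCutoff ε : EuclideanSpace ℝ (Fin d) → ℝ) := by
  refine HasCompactSupport.intro (isCompact_closedBall 0 (1 + ε)) fun x hx => ?_
  refine radialCutoff_of_ge hε ?_
  simp at hx
  exact hx.le

lemma integrable_radialCutoff {ε : ℝ} (hε : 0 < ε) :
    Integrable (radialCutoff ε : EuclideanSpace ℝ (Fin d) → ℝ) :=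
  (lipschitzWith_radialCutoff hε).continuous.integrable_of_hasCompactSupport
    (hasCompactSupport_radialCutoff hε)

/-- The open spherical shell between the radii `1` and `1 + ε`. -/
def shell (d : ℕ) (ε : ℝ) : Set (EuclideanSpace ℝ (Fin d)) := {x | ‖x‖ ∈ Set.Ioo 1 (1 + ε)}

lemma measurableSet_shell (ε : ℝ) : MeasurableSet (shell d ε) :=
  measurable_norm measurableSet_Ioo

lemma hasLineDerivAt_norm {x : EuclideanSpace ℝ (Fin d)} (hx : x ≠ 0)
    (v : EuclideanSpace ℝ (Fin d)) :
    HasLineDerivAt ℝ (fun y : EuclideanSpace ℝ (Fin d) => ‖y‖) (inner ℝ (‖x‖⁻¹ • x) v) x v := by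
  have hc : HasDerivAt (fun t : ℝ => x + t • v) v 0 := by
    simpa using ((hasDerivAt_id (0 : ℝ)).smul_const v).const_add x
  have h2 := hc.norm_sq.sqrt (by simpa using hx)
  have hpos : 0 < ‖x‖ := norm_pos_iff.2 hx
  simp only [Real.sqrt_sq (norm_nonneg _), zero_smul, add_zero] at h2
  rw [HasLineDerivAt]
  convert! h2 using 1
  rw [real_inner_smul_left]
  field_simp

lemma lineDeriv_radialCutoff {ε : ℝ} (hε : 0 < ε) {x : EuclideanSpace ℝ (Fin d)}
    (h1 : ‖x‖ ≠ 1) (h2 : ‖x‖ ≠ 1 + ε) (a : EuclideanSpace ℝ (Fin d)) :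
    lineDeriv ℝ (radialCutoff ε) x (-a) =
      (shell d ε).indicator (fun x => ε⁻¹ * inner ℝ (‖x‖⁻¹ • x) a) x := by
  have hcont : Continuous fun y : EuclideanSpace ℝ (Fin d) => ‖y‖ := continuous_norm
  rcases lt_or_gt_of_ne h1 with h1 | h1
  · have he : radialCutoff ε =ᶠ[𝓝 x] fun _ => (1 : ℝ) := by
      filter_upwards [hcont.continuousAt.eventually_lt continuousAt_const h1] with y hy
      exact radialCutoff_of_le_one hε hy.le
    rw [he.lineDeriv_eq, Set.indicator_of_notMem]
    · simp [lineDeriv]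
    · exact fun h => h.1.not_gt h1
  · rcases lt_or_gt_of_ne h2 with h2 | h2
    · have he : radialCutoff ε =ᶠ[𝓝 x] fun y => (1 + ε - ‖y‖) / ε := by
        filter_upwards [hcont.continuousAt.eventually_lt continuousAt_const h2,
          continuousAt_const.eventually_lt hcont.continuousAt h1] with y hy hy'
        exact radialCutoff_of_mem_shell hε hy'.le hy.le
      rw [he.lineDeriv_eq, Set.indicator_of_mem (show x ∈ shell d ε from ⟨h1, h2⟩)]
      have hx : x ≠ 0 := by
        rintro rfl
        simp at h1
        linarith
      have h3 : HasLineDerivAt ℝ (fun y : EuclideanSpace ℝ (Fin d) => (1 + ε - ‖y‖) / ε)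
          (-inner ℝ (‖x‖⁻¹ • x) (-a) / ε) x (-a) :=
        (HasDerivAt.const_sub (1 + ε) (hasLineDerivAt_norm hx (-a))).div_const ε
      rw [h3.lineDeriv, inner_neg_right, neg_neg, inv_mul_eq_div]
    · have he : radialCutoff ε =ᶠ[𝓝 x] fun _ => (0 : ℝ) := by
        filter_upwards [continuousAt_const.eventually_lt hcont.continuousAt h2] with y hy
        exact radialCutoff_of_ge hε hy.le
      rw [he.lineDeriv_eq, Set.indicator_of_notMem]
      · simp [lineDeriv]
      · exact fun h => h.2.not_gt h2

/-- On the line through `x`, the slope over `[-1, 0]` is at most the derivative at `0`. -/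
lemma sub_le_lineDeriv {F : EuclideanSpace ℝ (Fin d) → ℝ} (hF : ConvexOn ℝ Set.univ F)
    {x a : EuclideanSpace ℝ (Fin d)} (hx : LineDifferentiableAt ℝ F x a) :
    F x - F (x - a) ≤ lineDeriv ℝ F x a := by
  have hc : ConvexOn ℝ Set.univ fun t : ℝ => F (x + t • a) := by
    have := hF.comp_affineMap (AffineMap.lineMap x (x + a) : ℝ →ᵃ[ℝ] EuclideanSpace ℝ (Fin d))
    refine ConvexOn.congr (by simpa using this) fun t _ => ?_
    simp [AffineMap.lineMap_apply, add_comm]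
  have hd : HasDerivAt (fun t : ℝ => F (x + t • a)) (lineDeriv ℝ F x a) 0 := hx.hasLineDerivAt
  have := hc.slope_le_of_hasDerivAt (Set.mem_univ (-1)) (Set.mem_univ 0) (by norm_num) hd
  simpa [slope_def_field, ← sub_eq_add_neg] using this

lemma measureReal_ball_eq_pow_mul [NeZero d] {r : ℝ} (hr : 0 ≤ r) :
    volume.real (Metric.ball (0 : EuclideanSpace ℝ (Fin d)) r) =
      r ^ d * volume.real (Metric.ball (0 : EuclideanSpace ℝ (Fin d)) 1) := by
  rw [← Measure.addHaar_real_closedBall_eq_addHaar_real_ball volume 0 r,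
    Measure.addHaar_real_closedBall _ _ hr, finrank_euclideanSpace_fin]

lemma measureReal_shell [NeZero d] {ε : ℝ} (hε : 0 < ε) :
    volume.real (shell d ε) = ((1 + ε) ^ d - 1) *
      volume.real (Metric.ball (0 : EuclideanSpace ℝ (Fin d)) 1) := by
  have h : shell d ε = Metric.ball 0 (1 + ε) \ Metric.closedBall 0 1 := by
    ext x
    simp [shell, and_comm]
  rw [h, measureReal_sdiff (Metric.closedBall_subset_ball (by linarith)) measurableSet_closedBall,
    Measure.addHaar_real_closedBall _ _ zero_le_one, measureReal_ball_eq_pow_mul (by positivity)]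
  simp
  ring

lemma integrableOn_shell {k : EuclideanSpace ℝ (Fin d) → ℝ} {ε : ℝ}
    (hk : ContinuousOn k {x | x ≠ 0}) : IntegrableOn k (shell d ε) := by
  have hcomp : IsCompact {x : EuclideanSpace ℝ (Fin d) | 1 ≤ ‖x‖ ∧ ‖x‖ ≤ 1 + ε} :=
    Metric.isCompact_of_isClosed_isBounded
      ((isClosed_le continuous_const continuous_norm).inter
        (isClosed_le continuous_norm continuous_const))
      (isBounded_iff_forall_norm_le.2 ⟨1 + ε, fun x hx => hx.2⟩)
  refine ((hk.mono fun x hx => ?_).integrableOn_compact hcomp).mono_set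
    fun x hx => ⟨hx.1.le, hx.2.le⟩
  rintro rfl
  have := hx.1
  simp at this
  linarith

/-- The divergence theorem with a boundary layer of width `ε`: both sides estimate `∫ ∂ₐF · χ` for
the cutoff `χ`, from below by convexity and from above by moving the derivative onto `χ`, which
varies only in the shell. -/
lemma integral_cutoff_mul_le_shell [NeZero d] {L : ℝ≥0} {F : EuclideanSpace ℝ (Fin d) → ℝ}
    (hL : LipschitzWith L F) (hF : ConvexOn ℝ Set.univ F) (a : EuclideanSpace ℝ (Fin d))
    {ε : ℝ} (hε : 0 < ε) :
    (∫ x : EuclideanSpace ℝ (Fin d), radialCutoff ε x) * (F 0 - F (-a) - 2 * (1 + ε) * L) ≤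
      ε⁻¹ * (volume.real (shell d ε) *
        (∫ v, F v * inner ℝ v a ∂uniformSphere d + L * ε * ‖a‖)) := by
  have hFc := hL.continuous
  have hint1 : Integrable fun x => lineDeriv ℝ F x a * radialCutoff ε x :=
    (integrable_radialCutoff hε).bdd_mul (c := L * ‖a‖) (aestronglyMeasurable_lineDeriv hFc volume)
      (.of_forall fun x => norm_lineDeriv_le_of_lipschitz ℝ hL)
  have hlow : (∫ x : EuclideanSpace ℝ (Fin d), radialCutoff ε x) *
      (F 0 - F (-a) - 2 * (1 + ε) * L) ≤ ∫ x, lineDeriv ℝ F x a * radialCutoff ε x := by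
    rw [← integral_mul_const]
    refine integral_mono_ae ((integrable_radialCutoff hε).mul_const _) hint1 ?_
    filter_upwards [hL.ae_lineDifferentiableAt (μ := volume) a] with x hx
    rw [mul_comm]
    rcases le_or_gt (1 + ε) ‖x‖ with h | h
    · simp [radialCutoff_of_ge hε h]
    · refine mul_le_mul_of_nonneg_right ?_ (radialCutoff_nonneg ε x)
      refine le_trans ?_ (sub_le_lineDeriv hF hx)
      have h1 := hL.norm_sub_le 0 x
      have h2 := hL.norm_sub_le (x - a) (-a)
      rw [zero_sub, norm_neg] at h1
      rw [sub_neg_eq_add, sub_add_cancel] at h2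
      -- Replacing `x` by `0` and `x - a` by `-a` costs at most `L (1 + ε)` each.
      have h3 : (L : ℝ) * ‖x‖ ≤ L * (1 + ε) := by gcongr
      have h4 := le_of_abs_le h1
      have h5 := le_of_abs_le h2
      linarith
  have hdir : ContinuousOn (fun x : EuclideanSpace ℝ (Fin d) => ‖x‖⁻¹ • x) {x | x ≠ 0} :=
    ContinuousOn.smul (continuous_norm.continuousOn.inv₀ fun x hx => norm_ne_zero_iff.2 hx)
      continuousOn_id
  have hparts : ∫ x, lineDeriv ℝ F x a * radialCutoff ε x =
      ∫ x in shell d ε, ε⁻¹ * inner ℝ (‖x‖⁻¹ • x) a * F x := by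
    rw [hL.integral_lineDeriv_mul_eq (lipschitzWith_radialCutoff hε)
      (hasCompactSupport_radialCutoff hε), ← integral_indicator (measurableSet_shell ε)]
    refine integral_congr_ae ?_
    have h1 := measure_eq_zero_iff_ae_notMem.1
      (Measure.addHaar_sphere (volume : Measure (EuclideanSpace ℝ (Fin d))) 0 1)
    have h2 := measure_eq_zero_iff_ae_notMem.1
      (Measure.addHaar_sphere (volume : Measure (EuclideanSpace ℝ (Fin d))) 0 (1 + ε))
    filter_upwards [h1, h2] with x hx1 hx2
    rw [lineDeriv_radialCutoff hε (by simpa using hx1) (by simpa using hx2)]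
    by_cases hx : x ∈ shell d ε <;> simp [hx]
  -- Projecting the argument of `F` radially to the sphere moves it by at most `ε`, which makes the
  -- integrand purely angular.
  have hup : ∫ x in shell d ε, ε⁻¹ * inner ℝ (‖x‖⁻¹ • x) a * F x ≤
      ∫ x in shell d ε, ε⁻¹ * (F (‖x‖⁻¹ • x) * inner ℝ (‖x‖⁻¹ • x) a + L * ε * ‖a‖) := by
    refine setIntegral_mono_on (integrableOn_shell ?_) (integrableOn_shell ?_)
      (measurableSet_shell ε) fun x hx => ?_
    · exact (continuousOn_const.mul (hdir.inner continuousOn_const)).mul hFc.continuousOn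
    · exact continuousOn_const.mul (((hFc.comp_continuousOn hdir).mul
        (hdir.inner continuousOn_const)).add continuousOn_const)
    · have hx1 : 1 < ‖x‖ := hx.1
      have hx2 : ‖x‖ < 1 + ε := hx.2
      have hx0 : ‖x‖ ≠ 0 := by positivity
      rw [mul_assoc]
      refine mul_le_mul_of_nonneg_left ?_ (by positivity)
      set y := ‖x‖⁻¹ • x with hy
      have hy1 : ‖y‖ = 1 := by rw [hy, norm_smul, norm_inv, norm_norm, inv_mul_cancel₀ hx0]
      have hxy : ‖x - y‖ ≤ ε := by
        have : x - y = (‖x‖ - 1) • y := by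
          rw [sub_smul, one_smul, hy, smul_smul, mul_inv_cancel₀ hx0, one_smul]
        rw [this, norm_smul, hy1, mul_one, Real.norm_of_nonneg (by linarith)]
        linarith
      have h1 : |F x - F y| ≤ L * ε :=
        (hL.norm_sub_le x y).trans (mul_le_mul_of_nonneg_left hxy L.2)
      have h2 : |inner ℝ y a| ≤ ‖a‖ := by
        simpa [hy1] using abs_real_inner_le_norm y a
      have h3 : (F x - F y) * inner ℝ y a ≤ L * ε * ‖a‖ := by
        refine (le_abs_self _).trans ?_
        rw [abs_mul]
        exact mul_le_mul h1 h2 (abs_nonneg _) (by positivity)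
      linarith
  have hJ : Integrable (fun v => F v * inner ℝ v a) (uniformSphere d) := by
    refine integrable_of_bdd_on_sphere (by fun_prop) (B := (|F 0| + L) * ‖a‖) fun v hv => ?_
    rw [abs_mul]
    have h1 : |F v| ≤ |F 0| + L := by
      have h := hL.norm_sub_le v 0
      rw [sub_zero, hv, mul_one, Real.norm_eq_abs] at h
      have := abs_sub_abs_le_abs_sub (F v) (F 0)
      linarith
    have h2 : |inner ℝ v a| ≤ ‖a‖ := by simpa [hv] using abs_real_inner_le_norm v a
    gcongr
  have hpolar : ∫ x in shell d ε, ε⁻¹ * (F (‖x‖⁻¹ • x) * inner ℝ (‖x‖⁻¹ • x) a + L * ε * ‖a‖) =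
      ε⁻¹ * (volume.real (shell d ε) *
        (∫ v, F v * inner ℝ v a ∂uniformSphere d + L * ε * ‖a‖)) := by
    have h := integral_radial_mul_angular (d := d) ((Set.Ioo 1 (1 + ε)).indicator 1)
      fun v => F v * inner ℝ v a + L * ε * ‖a‖
    rw [integral_add hJ (integrable_const _), integral_const, probReal_univ, one_smul] at h
    have hind : ∀ x : EuclideanSpace ℝ (Fin d),
        (Set.Ioo 1 (1 + ε)).indicator (1 : ℝ → ℝ) ‖x‖ = (shell d ε).indicator 1 x := fun x => by
      by_cases hx : x ∈ shell d ε
      · rw [Set.indicator_of_mem hx, Set.indicator_of_mem (show ‖x‖ ∈ Set.Ioo 1 (1 + ε) from hx)]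
        rfl
      · rw [Set.indicator_of_notMem hx,
          Set.indicator_of_notMem (show ‖x‖ ∉ Set.Ioo 1 (1 + ε) from hx)]
    simp_rw [hind] at h
    rw [integral_indicator_one (measurableSet_shell ε)] at h
    rw [integral_const_mul, ← h, ← integral_indicator (measurableSet_shell ε)]
    congr 2
    ext x
    by_cases hx : x ∈ shell d ε <;> simp [hx]
  exact hlow.trans ((hparts.trans_le hup).trans hpolar.le)

/-- The expectation of the two-point estimator's one-sided half is, up to an error of order the
Lipschitz constant, at least a difference of function values: it is the gradient of the average of
`F` over a ball. -/
lemma sub_le_integral_uniformSphere [NeZero d] {L : ℝ≥0} {F : EuclideanSpace ℝ (Fin d) → ℝ}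
    (hL : LipschitzWith L F) (hF : ConvexOn ℝ Set.univ F) (a : EuclideanSpace ℝ (Fin d)) :
    F 0 - F (-a) - 2 * L ≤ d * ∫ v, F v * inner ℝ v a ∂uniformSphere d := by
  set V := volume.real (Metric.ball (0 : EuclideanSpace ℝ (Fin d)) 1) with hV
  set J := ∫ v, F v * inner ℝ v a ∂uniformSphere d
  have hVpos : 0 < V := by
    rw [hV, measureReal_def]
    exact ENNReal.toReal_pos (Metric.measure_ball_pos _ _ one_pos).ne' measure_ball_lt_top.ne
  -- The normalized mass of the cutoff, squeezed to `1` between the volumes of the balls of radii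
  -- `1` and `1 + ε`.
  let m : ℝ → ℝ := fun ε => (∫ x : EuclideanSpace ℝ (Fin d), radialCutoff ε x) / V
  have hm1 : ∀ ε, 0 < ε → 1 ≤ m ε := by
    intro ε hε
    rw [le_div_iff₀ hVpos, one_mul, hV, ← integral_indicator_one measurableSet_ball]
    refine integral_mono ((integrable_indicator_iff measurableSet_ball).2
      (integrableOn_const measure_ball_lt_top.ne)) (integrable_radialCutoff hε) fun x => ?_
    by_cases hx : x ∈ Metric.ball (0 : EuclideanSpace ℝ (Fin d)) 1
    · rw [Set.indicator_of_mem hx, radialCutoff_of_le_one hε (mem_ball_zero_iff.1 hx).le]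
      exact le_rfl
    · rw [Set.indicator_of_notMem hx]
      exact radialCutoff_nonneg ε x
  have hm2 : ∀ ε, 0 < ε → m ε ≤ (1 + ε) ^ d := by
    intro ε hε
    have h := measureReal_ball_eq_pow_mul (d := d) (r := 1 + ε) (by positivity)
    rw [div_le_iff₀ hVpos, ← h, ← integral_indicator_one measurableSet_ball]
    refine integral_mono (integrable_radialCutoff hε)
      ((integrable_indicator_iff measurableSet_ball).2
        (integrableOn_const measure_ball_lt_top.ne)) fun x => ?_
    by_cases hx : x ∈ Metric.ball (0 : EuclideanSpace ℝ (Fin d)) (1 + ε)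
    · rw [Set.indicator_of_mem hx]
      exact radialCutoff_le_one ε x
    · rw [Set.indicator_of_notMem hx, radialCutoff_of_ge hε (by simpa using hx)]
  have hmain : ∀ ε, 0 < ε → m ε * (F 0 - F (-a) - 2 * (1 + ε) * L) ≤
      ε⁻¹ * ((1 + ε) ^ d - 1) * (J + L * ε * ‖a‖) := by
    intro ε hε
    have h := integral_cutoff_mul_le_shell hL hF a hε
    rw [measureReal_shell hε] at h
    simp only [m]
    rw [div_mul_eq_mul_div, div_le_iff₀ hVpos]
    refine h.trans_eq ?_
    ring
  have hid : Tendsto (fun ε : ℝ => ε) (𝓝[>] 0) (𝓝 0) := nhdsWithin_le_nhds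
  have hpow : Tendsto (fun ε : ℝ => (1 + ε) ^ d) (𝓝[>] 0) (𝓝 1) := by
    simpa using (hid.const_add 1).pow d
  have hm : Tendsto m (𝓝[>] 0) (𝓝 1) := by
    refine tendsto_of_tendsto_of_tendsto_of_le_of_le' tendsto_const_nhds hpow ?_ ?_
    · filter_upwards [self_mem_nhdsWithin] with ε hε using hm1 ε hε
    · filter_upwards [self_mem_nhdsWithin] with ε hε using hm2 ε hε
  have hl : Tendsto (fun ε => m ε * (F 0 - F (-a) - 2 * (1 + ε) * L)) (𝓝[>] 0)
      (𝓝 (1 * (F 0 - F (-a) - 2 * (1 + 0) * L))) :=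
    hm.mul ((((hid.const_add 1).const_mul 2).mul_const _).const_sub _)
  have hder : HasDerivAt (fun ε : ℝ => (1 + ε) ^ d) d 0 := by
    have := ((hasDerivAt_id (0 : ℝ)).const_add 1).fun_pow d
    simpa using this
  -- The relative volume of the shell per unit width tends to `d`: this is the dimension factor of
  -- the estimator.
  have hsl : Tendsto (fun ε : ℝ => ε⁻¹ * ((1 + ε) ^ d - 1)) (𝓝[>] 0) (𝓝 (d : ℝ)) := by
    refine (hder.tendsto_slope_zero_right).congr fun t => ?_
    simp
  have hr : Tendsto (fun ε => ε⁻¹ * ((1 + ε) ^ d - 1) * (J + L * ε * ‖a‖)) (𝓝[>] 0)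
      (𝓝 (d * (J + L * 0 * ‖a‖))) :=
    hsl.mul (((hid.const_mul _).mul_const _).const_add _)
  have := le_of_tendsto_of_tendsto hl hr (by
    filter_upwards [self_mem_nhdsWithin] with ε hε using hmain ε hε)
  simpa using this

end Flux

/-! ### Deterministic analysis of mirror descent -/

section MirrorDescent

open Filter Topology
open scoped NNReal

variable {d : ℕ} {N : Seminorm ℝ (EuclideanSpace ℝ (Fin d))}
  {W : Set (EuclideanSpace ℝ (Fin d))} {r : EuclideanSpace ℝ (Fin d) → ℝ}

/-- Quadratic growth of the regularized linear objective away from its maximizer. -/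
lemma IsStronglyConvexOn.quadratic_growth (hr : IsStronglyConvexOn N W r)
    {θ w x : EuclideanSpace ℝ (Fin d)} (hw : w ∈ W)
    (hmax : IsMaxOn (fun x => inner ℝ θ x - r x) W w) (hx : x ∈ W) :
    inner ℝ θ x - r x + 1 / 2 * N (x - w) ^ 2 ≤ inner ℝ θ w - r w := by
  -- Compare `w` with `b • x + (1 - b) • w`, divide by `b`, then let `b → 0`.
  have key : ∀ b : ℝ, 0 < b → b < 1 →
      inner ℝ θ x - r x + (1 - b) * (1 / 2 * N (x - w) ^ 2) ≤ inner ℝ θ w - r w := by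
    intro b hb hb1
    have h1 := hr.2 x hx w hw b (1 - b) hb.le (by linarith) (by ring)
    have hmem : b • x + (1 - b) • w ∈ W := hr.1 hx hw hb.le (by linarith) (by ring)
    have h2 := hmax hmem
    simp only [Set.mem_ofPred_eq, inner_add_right, real_inner_smul_right] at h2
    have h3 : b * (inner ℝ θ x - r x + (1 - b) * (1 / 2 * N (x - w) ^ 2)) ≤
        b * (inner ℝ θ w - r w) := by linarith
    exact le_of_mul_le_mul_left h3 hb
  have hid : Tendsto (fun b : ℝ => b) (𝓝[>] 0) (𝓝 0) := nhdsWithin_le_nhds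
  have hlim : Tendsto (fun b : ℝ => inner ℝ θ x - r x + (1 - b) * (1 / 2 * N (x - w) ^ 2))
      (𝓝[>] 0) (𝓝 (inner ℝ θ x - r x + (1 - 0) * (1 / 2 * N (x - w) ^ 2))) :=
    ((hid.const_sub 1).mul_const _).const_add _
  rw [sub_zero, one_mul] at hlim
  refine le_of_tendsto hlim ?_
  filter_upwards [Ioo_mem_nhdsGT one_pos] with b hb using key b hb.1 hb.2

/-- The quadratic growth term absorbs `η ⟨g, w - x⟩` by Young's inequality, leaving `η² ‖g‖_*² / 2`.
-/
lemma IsStronglyConvexOn.step_le (hN : ∀ x, N x = 0 → x = 0) (hr : IsStronglyConvexOn N W r)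
    {θ w x : EuclideanSpace ℝ (Fin d)} (hw : w ∈ W)
    (hmax : IsMaxOn (fun x => inner ℝ θ x - r x) W w) (hx : x ∈ W) (η : ℝ)
    (g : EuclideanSpace ℝ (Fin d)) :
    inner ℝ (θ - η • g) x - r x ≤
      inner ℝ θ w - r w - η * inner ℝ g w + η ^ 2 / 2 * dualNorm N g ^ 2 := by
  have h1 := hr.quadratic_growth hw hmax hx
  have h2 := inner_le_dualNorm_mul hN g (η • (w - x))
  rw [map_smul_eq_mul, Real.norm_eq_abs, real_inner_smul_right, inner_sub_right,
    map_sub_rev N w x] at h2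
  rw [inner_sub_left, real_inner_smul_left]
  have h3 := two_mul_le_add_sq (|η| * dualNorm N g) (N (x - w))
  rw [mul_pow, sq_abs] at h3
  linarith

/-- The deterministic regret bound of mirror descent with linear losses `g 0, …, g (T - 1)`. -/
lemma IsStronglyConvexOn.regret_le (hN : ∀ x, N x = 0 → x = 0) (hr : IsStronglyConvexOn N W r)
    {T : ℕ} (hT : 0 < T) {η : ℝ} {θ w g : ℕ → EuclideanSpace ℝ (Fin d)} (h0 : θ 0 = 0)
    (hw : ∀ t < T, w t ∈ W ∧ IsMaxOn (fun x => inner ℝ (θ t) x - r x) W (w t))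
    (hθ : ∀ t < T, θ (t + 1) = θ t - η • g t) {x : EuclideanSpace ℝ (Fin d)} (hx : x ∈ W) :
    η * ∑ t ∈ Finset.range T, inner ℝ (g t) (w t - x) ≤
      r x - r (w 0) + η ^ 2 / 2 * ∑ t ∈ Finset.range T, dualNorm N (g t) ^ 2 := by
  -- A bound on the potential `sup (⟨θ n, y⟩ - r y)`, stated for each `y` because no maximizer is
  -- provided at `n = T`. It starts from `-r (w 0)`, since `θ 0 = 0`.
  have key : ∀ n ≤ T, ∀ y ∈ W, inner ℝ (θ n) y - r y ≤ -r (w 0) -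
      η * ∑ t ∈ Finset.range n, inner ℝ (g t) (w t) +
      η ^ 2 / 2 * ∑ t ∈ Finset.range n, dualNorm N (g t) ^ 2 := by
    intro n
    induction n with
    | zero =>
      intro _ y hy
      have := (hw 0 hT).2 hy
      simpa [h0] using this
    | succ n ih =>
      intro hn y hy
      obtain ⟨h1, h2⟩ := hw n hn
      have h3 := hr.step_le hN h1 h2 hy η (g n)
      have h4 := ih (by omega) _ h1
      rw [hθ n hn, Finset.sum_range_succ, Finset.sum_range_succ]
      linarith
  have hsum : ∀ n ≤ T, inner ℝ (θ n) x = -(η * ∑ t ∈ Finset.range n, inner ℝ (g t) x) := by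
    intro n
    induction n with
    | zero => simp [h0]
    | succ n ih =>
      intro hn
      rw [hθ n hn, inner_sub_left, real_inner_smul_left, ih (by omega), Finset.sum_range_succ]
      ring
  have h1 := key T le_rfl x hx
  rw [hsum T le_rfl] at h1
  simp_rw [inner_sub_right]
  rw [Finset.sum_sub_distrib]
  linarith

/-- Strong convexity at the midpoint. It makes `W` bounded, which gives the integrability of the
regret. -/
lemma IsStronglyConvexOn.sq_sub_le (hr : IsStronglyConvexOn N W r) {R : ℝ}
    (hR : ∀ x ∈ W, ∀ y ∈ W, r x - r y ≤ R ^ 2) {x y : EuclideanSpace ℝ (Fin d)} (hx : x ∈ W)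
    (hy : y ∈ W) : N (x - y) ^ 2 ≤ 8 * R ^ 2 := by
  have h1 := hr.2 x hx y hy (1 / 2) (1 / 2) (by norm_num) (by norm_num) (by norm_num)
  have hm : (1 / 2 : ℝ) • x + (1 / 2 : ℝ) • y ∈ W :=
    hr.1 hx hy (by norm_num) (by norm_num) (by norm_num)
  have h2 := hR x hx _ hm
  have h3 := hR y hy _ hm
  linarith

lemma IsStronglyConvexOn.exists_norm_sub_le (hN : ∀ x, N x = 0 → x = 0)
    (hr : IsStronglyConvexOn N W r) {R : ℝ} (hR : ∀ x ∈ W, ∀ y ∈ W, r x - r y ≤ R ^ 2) :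
    ∃ D : ℝ, ∀ x ∈ W, ∀ y ∈ W, ‖x - y‖ ≤ D := by
  obtain ⟨c, hc, h⟩ := exists_pos_mul_norm_le hN
  refine ⟨√(8 * R ^ 2) / c, fun x hx y hy => ?_⟩
  rw [le_div_iff₀ hc, mul_comm]
  exact (h _).trans (Real.le_sqrt_of_sq_le (hr.sq_sub_le hR hx hy))

/-- The maximizer depends continuously on the dual vector. -/
lemma IsStronglyConvexOn.exists_continuous_argmax (hN : ∀ x, N x = 0 → x = 0)
    (hr : IsStronglyConvexOn N W r) :
    ∃ Ψ : EuclideanSpace ℝ (Fin d) → EuclideanSpace ℝ (Fin d), Continuous Ψ ∧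
      ∀ θ w, w ∈ W → IsMaxOn (fun x => inner ℝ θ x - r x) W w → w = Ψ θ := by
  obtain ⟨c, hc, hcN⟩ := exists_pos_mul_norm_le hN
  have hlip : ∀ θ₁ θ₂ w₁ w₂ : EuclideanSpace ℝ (Fin d), w₁ ∈ W → w₂ ∈ W →
      IsMaxOn (fun x => inner ℝ θ₁ x - r x) W w₁ → IsMaxOn (fun x => inner ℝ θ₂ x - r x) W w₂ →
      ‖w₁ - w₂‖ ≤ (c ^ 2)⁻¹ * ‖θ₁ - θ₂‖ := by
    intro θ₁ θ₂ w₁ w₂ h₁ h₂ hm₁ hm₂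
    -- Adding the growth inequalities of the two maximizers gives `N (w₁ - w₂)² ≤ ⟨θ₁ - θ₂, w₁ -
    -- w₂⟩`.
    have g1 := hr.quadratic_growth h₁ hm₁ h₂
    have g2 := hr.quadratic_growth h₂ hm₂ h₁
    rw [map_sub_rev N w₂ w₁] at g1
    have h3 := pow_le_pow_left₀ (by positivity) (hcN (w₁ - w₂)) 2
    have h4 := real_inner_le_norm (θ₁ - θ₂) (w₁ - w₂)
    simp only [inner_sub_left, inner_sub_right] at h4
    rcases (norm_nonneg (w₁ - w₂)).eq_or_lt with h0 | h0
    · rw [← h0]; positivity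
    · rw [inv_mul_eq_div, le_div_iff₀ (by positivity)]
      refine le_of_mul_le_mul_right ?_ h0
      rw [mul_pow] at h3
      linarith
  -- Maximizers may exist only for `θ ∈ S`, so a choice on `S` is extended as a Lipschitz map to the
  -- whole space.
  let S : Set (EuclideanSpace ℝ (Fin d)) :=
    {θ | ∃ w ∈ W, IsMaxOn (fun x => inner ℝ θ x - r x) W w}
  have hS : ∀ θ : EuclideanSpace ℝ (Fin d), ∃ w, θ ∈ S →
      w ∈ W ∧ IsMaxOn (fun x => inner ℝ θ x - r x) W w := by
    intro θ
    by_cases h : θ ∈ S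
    · obtain ⟨w, hw⟩ := h
      exact ⟨w, fun _ => hw⟩
    · exact ⟨0, fun h' => (h h').elim⟩
  choose A hA using hS
  have hAlip : LipschitzOnWith ⟨(c ^ 2)⁻¹, by positivity⟩ A S :=
    LipschitzOnWith.of_dist_le_mul fun θ₁ h₁ θ₂ h₂ => by
      rw [dist_eq_norm, dist_eq_norm]
      exact hlip _ _ _ _ (hA θ₁ h₁).1 (hA θ₂ h₂).1 (hA θ₁ h₁).2 (hA θ₂ h₂).2
  obtain ⟨Ψ, hΨ, heq⟩ := hAlip.extend_finite_dimension
  refine ⟨Ψ, hΨ.continuous, fun θ w hw hm => ?_⟩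
  have hθ : θ ∈ S := ⟨w, hw, hm⟩
  have := hlip θ θ w (A θ) hw (hA θ hθ).1 hm (hA θ hθ).2
  rw [sub_self, norm_zero, mul_zero, norm_le_zero_iff, sub_eq_zero] at this
  rw [this, heq hθ]

end MirrorDescent

/-! ### Bias and second moment of the two-point estimator -/

section Estimator

open scoped NNReal

variable {d : ℕ}

lemma lipschitzWith_of_abs_sub_le {f : EuclideanSpace ℝ (Fin d) → ℝ} {G : ℝ}
    (hf : ∀ x y, |f x - f y| ≤ G * ‖x - y‖) : LipschitzWith (Real.toNNReal G) f :=
  LipschitzWith.of_dist_le' fun x y => by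
    rw [Real.dist_eq, dist_eq_norm]
    exact hf x y

/-- A crude bound that serves only integrability; its square is of order `d²`, too large for the
regret. -/
lemma norm_gradEstimate_le {f : EuclideanSpace ℝ (Fin d) → ℝ} {G δ : ℝ} (hδ : 0 < δ)
    (hf : ∀ x y, |f x - f y| ≤ G * ‖x - y‖) (w : EuclideanSpace ℝ (Fin d))
    {v : EuclideanSpace ℝ (Fin d)} (hv : ‖v‖ = 1) : ‖gradEstimate δ f w v‖ ≤ d * G := by
  have h1 : |f (w + δ • v) - f (w - δ • v)| ≤ G * (2 * δ) := by
    refine (hf _ _).trans_eq ?_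
    have : w + δ • v - (w - δ • v) = (2 * δ) • v := by module
    rw [this, norm_smul, hv, mul_one, Real.norm_of_nonneg (by positivity)]
  rw [gradEstimate, norm_smul, hv, mul_one, Real.norm_eq_abs, abs_mul,
    abs_of_nonneg (by positivity)]
  calc (d : ℝ) / (2 * δ) * |f (w + δ • v) - f (w - δ • v)|
      ≤ d / (2 * δ) * (G * (2 * δ)) := by gcongr
    _ = d * G := by field_simp

/-- The two-point estimator is, up to the smoothing error `2 δ G`, a subgradient in expectation. -/
lemma sub_le_integral_inner_gradEstimate [NeZero d] {f : EuclideanSpace ℝ (Fin d) → ℝ} {G δ : ℝ}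
    (hG : 0 ≤ G) (hδ : 0 < δ) (hf : ∀ x y, |f x - f y| ≤ G * ‖x - y‖)
    (hconv : ConvexOn ℝ Set.univ f) (w x : EuclideanSpace ℝ (Fin d)) :
    f w - f x - 2 * δ * G ≤ ∫ v, inner ℝ (gradEstimate δ f w v) (w - x) ∂uniformSphere d := by
  let F : EuclideanSpace ℝ (Fin d) → ℝ := fun v => f (w + δ • v)
  have hL : LipschitzWith (Real.toNNReal (δ * G)) F := LipschitzWith.of_dist_le' fun v v' => by
    rw [Real.dist_eq, dist_eq_norm]
    refine (hf _ _).trans_eq ?_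
    rw [add_sub_add_left_eq_sub, ← smul_sub, norm_smul, Real.norm_of_nonneg hδ.le]
    ring
  have hF : ConvexOn ℝ Set.univ F := by
    refine ⟨convex_univ, fun v _ v' _ a b ha hb hab => ?_⟩
    have h := hconv.2 (Set.mem_univ (w + δ • v)) (Set.mem_univ (w + δ • v')) ha hb hab
    have h2 : a • (w + δ • v) + b • (w + δ • v') = w + δ • (a • v + b • v') := by
      have : w = (a + b) • w := by rw [hab, one_smul]
      conv_rhs => rw [this]
      module
    rwa [h2] at h
  -- In the rescaled variable `v` the comparator sits at `-a` for `a = δ⁻¹ (w - x)`, and the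
  -- Lipschitz constant of `F` is `δ G`.
  have h := sub_le_integral_uniformSphere hL hF (δ⁻¹ • (w - x))
  have hx : F (-(δ⁻¹ • (w - x))) = f x := by
    simp only [F]
    rw [smul_neg, smul_smul, mul_inv_cancel₀ hδ.ne', one_smul]
    congr 1
    abel
  have h0 : F 0 = f w := by simp [F]
  rw [hx, h0] at h
  rw [Real.coe_toNNReal _ (by positivity)] at h
  simp only [real_inner_smul_right] at h
  have hFc := hL.continuous
  have hint : Integrable (fun v => F v * inner ℝ v (w - x)) (uniformSphere d) := by
    obtain ⟨B, hB⟩ := (isCompact_sphere (0 : EuclideanSpace ℝ (Fin d)) 1).exists_bound_of_continuousOn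
      (f := fun v => F v * inner ℝ v (w - x)) (by fun_prop)
    exact integrable_of_bdd_on_sphere (by fun_prop) fun v hv => hB v (by simpa using hv)
  have hint' : Integrable (fun v => F (-v) * inner ℝ (-v) (w - x)) (uniformSphere d) := by
    obtain ⟨B, hB⟩ := (isCompact_sphere (0 : EuclideanSpace ℝ (Fin d)) 1).exists_bound_of_continuousOn
      (f := fun v => F (-v) * inner ℝ (-v) (w - x)) (by fun_prop)
    exact integrable_of_bdd_on_sphere (by fun_prop) fun v hv => hB v (by simpa using hv)
  have heq : ∫ v, inner ℝ (gradEstimate δ f w v) (w - x) ∂uniformSphere d =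
      d * ∫ v, F v * (δ⁻¹ * inner ℝ v (w - x)) ∂uniformSphere d := by
    have h1 : ∀ v, inner ℝ (gradEstimate δ f w v) (w - x) = d / (2 * δ) *
        (F v * inner ℝ v (w - x) + F (-v) * inner ℝ (-v) (w - x)) := by
      intro v
      simp only [gradEstimate, F]
      rw [real_inner_smul_left, inner_neg_left, smul_neg, ← sub_eq_add_neg]
      ring
    have h2 : ∀ v, F v * (δ⁻¹ * inner ℝ v (w - x)) = δ⁻¹ * (F v * inner ℝ v (w - x)) :=
      fun v => by ring
    simp_rw [h1, h2]
    rw [integral_const_mul, integral_const_mul, integral_add hint hint',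
      integral_uniformSphere_comp_neg fun v => F v * inner ℝ v (w - x)]
    field_simp
    ring
  rw [heq]
  linarith

/-- The second moment of the two-point estimator in the dual norm is of order `d`. -/
lemma integral_dualNorm_gradEstimate_sq_le [NeZero d]
    {N : Seminorm ℝ (EuclideanSpace ℝ (Fin d))} (hN : ∀ x, N x = 0 → x = 0)
    {f : EuclideanSpace ℝ (Fin d) → ℝ} {G δ p : ℝ} (hG : 0 < G) (hδ : 0 < δ) (hp : 0 < p)
    (hp4 : ∫ v, dualNorm N v ^ 4 ∂uniformSphere d ≤ p ^ 4)
    (hf : ∀ x y, |f x - f y| ≤ G * ‖x - y‖) (w : EuclideanSpace ℝ (Fin d)) :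
    ∫ v, dualNorm N (gradEstimate δ f w v) ^ 2 ∂uniformSphere d ≤
      √(sphereConst + 1) * d * p ^ 2 * G ^ 2 := by
  let h : EuclideanSpace ℝ (Fin d) → ℝ := fun v => f (w + δ • v) - f (w - δ • v)
  set L : ℝ := 2 * δ * G with hLdef
  have hLpos : 0 < L := by positivity
  have hL : LipschitzWith (Real.toNNReal L) h := LipschitzWith.of_dist_le' fun v v' => by
    rw [Real.dist_eq, dist_eq_norm]
    have h1 := hf (w + δ • v) (w + δ • v')
    have h2 := hf (w - δ • v) (w - δ • v')
    rw [add_sub_add_left_eq_sub, ← smul_sub, norm_smul, Real.norm_of_nonneg hδ.le] at h1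
    rw [sub_sub_sub_cancel_left, ← smul_sub, norm_smul, Real.norm_of_nonneg hδ.le,
      norm_sub_rev] at h2
    have h3 : h v - h v' = (f (w + δ • v) - f (w + δ • v')) -
      (f (w - δ • v) - f (w - δ • v')) := by simp only [h]; ring
    rw [h3]
    refine (abs_sub _ _).trans ?_
    linarith
  have hodd : ∀ v, h (-v) = -h v := fun v => by
    simp only [h, smul_neg, sub_neg_eq_add, ← sub_eq_add_neg]
    ring
  have hhc := hL.continuous
  have hd : (0 : ℝ) < d := by exact_mod_cast NeZero.pos d
  have hC : 0 < sphereConst + 1 := by linarith [sphereConst_nonneg]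
  -- `X` bounds the square root of the fourth moment of `h`. The `+ 1` makes it positive, so that it
  -- can be divided by.
  set X : ℝ := √(sphereConst + 1) * L ^ 2 / d with hX
  have hXpos : 0 < X := by positivity
  have hX2 : ∫ v, h v ^ 4 ∂uniformSphere d ≤ X ^ 2 := by
    have h1 := integral_pow_four_uniformSphere_le hL hodd
    rw [Real.coe_toNNReal _ hLpos.le] at h1
    rw [hX, div_pow, mul_pow, Real.sq_sqrt hC.le, le_div_iff₀ (by positivity), mul_comm]
    refine h1.trans ?_
    have h2 : (L ^ 2) ^ 2 = L ^ 4 := by ring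
    rw [h2]
    have : 0 < L ^ 4 := by positivity
    linarith
  have hint1 : Integrable (fun v => h v ^ 4) (uniformSphere d) := by
    obtain ⟨B, hB⟩ := (isCompact_sphere (0 : EuclideanSpace ℝ (Fin d)) 1).exists_bound_of_continuousOn
      (f := fun v => h v ^ 4) (by fun_prop)
    exact integrable_of_bdd_on_sphere (by fun_prop) fun v hv => hB v (by simpa using hv)
  have hint2 := integrable_dualNorm_pow hN 4
  -- Cauchy–Schwarz in pointwise form: Young's inequality, weighted so that the two terms have equal
  -- bounds after integration.
  have hpt : ∀ v, dualNorm N (gradEstimate δ f w v) ^ 2 ≤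
      (d / (2 * δ)) ^ 2 * (p ^ 2 / (2 * X) * h v ^ 4 + X / (2 * p ^ 2) * dualNorm N v ^ 4) := by
    intro v
    have h1 : dualNorm N (gradEstimate δ f w v) ≤ |d / (2 * δ) * h v| * dualNorm N v :=
      dualNorm_smul_le hN _ _
    have h2 := pow_le_pow_left₀ (dualNorm_nonneg hN _) h1 2
    refine h2.trans ?_
    rw [mul_pow, sq_abs, mul_pow, mul_assoc]
    refine mul_le_mul_of_nonneg_left ?_ (by positivity)
    have h3 := two_mul_le_add_sq (p ^ 2 * h v ^ 2) (X * dualNorm N v ^ 2)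
    have h4 : p ^ 2 / (2 * X) * h v ^ 4 + X / (2 * p ^ 2) * dualNorm N v ^ 4 =
        ((p ^ 2 * h v ^ 2) ^ 2 + (X * dualNorm N v ^ 2) ^ 2) / (2 * (X * p ^ 2)) := by
      field_simp
    rw [h4, le_div_iff₀ (by positivity)]
    linarith
  refine (integral_mono_of_nonneg (.of_forall fun v => by positivity)
    (((hint1.const_mul _).add (hint2.const_mul _)).const_mul _) (.of_forall hpt)).trans ?_
  rw [integral_const_mul, integral_add' (hint1.const_mul _) (hint2.const_mul _),
    integral_const_mul, integral_const_mul]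
  calc _ ≤ (d / (2 * δ)) ^ 2 * (p ^ 2 / (2 * X) * X ^ 2 + X / (2 * p ^ 2) * p ^ 4) := by gcongr
    _ = (d / (2 * δ)) ^ 2 * (p ^ 2 * X) := by field_simp; norm_num
    _ = _ := by rw [hX, hLdef]; field_simp

end Estimator

/-! ### Joint measurability and freezing -/

section Randomness

variable {d : ℕ} {Ω : Type*}

lemma measurable_uncurry_loss {m : MeasurableSpace Ω} {f : Ω → EuclideanSpace ℝ (Fin d) → ℝ}
    (hf : ∀ x, Measurable fun ω => f ω x) (hc : ∀ ω, Continuous (f ω)) :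
    Measurable fun q : Ω × EuclideanSpace ℝ (Fin d) => f q.1 q.2 :=
  (measurable_uncurry_of_continuous_of_measurable (u := fun x ω => f ω x) hc hf).comp
    measurable_swap

lemma measurable_gradEstimate {m : MeasurableSpace Ω} {f : Ω → EuclideanSpace ℝ (Fin d) → ℝ}
    (hf : ∀ x, Measurable fun ω => f ω x) (hc : ∀ ω, Continuous (f ω)) (δ : ℝ)
    {w : Ω → EuclideanSpace ℝ (Fin d)} (hw : Measurable w) :
    Measurable fun q : Ω × EuclideanSpace ℝ (Fin d) => gradEstimate δ (f q.1) (w q.1) q.2 := by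
  have h := measurable_uncurry_loss hf hc
  have hw' : Measurable fun q : Ω × EuclideanSpace ℝ (Fin d) => w q.1 := hw.comp measurable_fst
  have h1 : Measurable fun q : Ω × EuclideanSpace ℝ (Fin d) => f q.1 (w q.1 + δ • q.2) :=
    h.comp (measurable_fst.prodMk (hw'.add (measurable_snd.const_smul δ)))
  have h2 : Measurable fun q : Ω × EuclideanSpace ℝ (Fin d) => f q.1 (w q.1 - δ • q.2) :=
    h.comp (measurable_fst.prodMk (hw'.sub (measurable_snd.const_smul δ)))
  exact ((h1.sub h2).const_mul _).smul measurable_snd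

variable {Ω' : Type*} [MeasurableSpace Ω] [MeasurableSpace Ω'] {μ : Measure Ω}
  [IsProbabilityMeasure μ] {X : Ω → Ω'} {u : Ω → EuclideanSpace ℝ (Fin d)}
  {K : Ω' → EuclideanSpace ℝ (Fin d) → ℝ} {B : ℝ}

/-- Freezing: a bounded function of `X` and of an independent uniform direction `u` may be
integrated over the direction first. -/
lemma integral_comp_uniform_direction [NeZero d] (hX : Measurable X) (hu : Measurable u)
    (hlaw : μ.map u = uniformSphere d) (hind : IndepFun X u μ)
    (hK : Measurable fun q : Ω' × EuclideanSpace ℝ (Fin d) => K q.1 q.2)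
    (hB : ∀ x v, ‖v‖ = 1 → |K x v| ≤ B) :
    Integrable (fun ω => K (X ω) (u ω)) μ ∧
      Integrable (fun ω => ∫ v, K (X ω) v ∂uniformSphere d) μ ∧
      ∫ ω, K (X ω) (u ω) ∂μ = ∫ ω, ∫ v, K (X ω) v ∂uniformSphere d ∂μ := by
  have hmap := (indepFun_iff_map_prod_eq_prod_map_map hX.aemeasurable hu.aemeasurable).1 hind
  rw [hlaw] at hmap
  have : IsProbabilityMeasure (μ.map X) := Measure.isProbabilityMeasure_map hX.aemeasurable
  have hint : Integrable (fun q : Ω' × EuclideanSpace ℝ (Fin d) => K q.1 q.2)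
      ((μ.map X).prod (uniformSphere d)) := by
    refine Integrable.of_bound hK.aestronglyMeasurable B ?_
    filter_upwards [Measure.quasiMeasurePreserving_snd.ae ae_norm_uniformSphere] with q hq
    exact hB _ _ hq
  have hpair : Measurable fun ω => (X ω, u ω) := hX.prodMk hu
  have hinner := hint.integral_prod_left
  refine ⟨?_, hinner.comp_measurable hX, ?_⟩
  · rw [← hmap] at hint
    exact hint.comp_measurable hpair
  · calc ∫ ω, K (X ω) (u ω) ∂μ
        = ∫ q, K q.1 q.2 ∂μ.map fun ω => (X ω, u ω) :=
          (integral_map hpair.aemeasurable hK.aestronglyMeasurable).symm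
      _ = ∫ x, ∫ v, K x v ∂uniformSphere d ∂μ.map X := by rw [hmap, integral_prod _ hint]
      _ = _ := integral_map hX.aemeasurable hinner.aestronglyMeasurable

end Randomness

/-! ### Measurability and conditioning along a run -/

section Run

variable {d : ℕ} {Ω : Type*} [mΩ : MeasurableSpace Ω] {μ : Measure Ω} {ℱ : Filtration ℕ mΩ}
  {T : ℕ} {W : Set (EuclideanSpace ℝ (Fin d))} {N : Seminorm ℝ (EuclideanSpace ℝ (Fin d))}
  {r : EuclideanSpace ℝ (Fin d) → ℝ} {η G R p : ℝ} {δ : ℕ → ℝ}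
  {f : ℕ → Ω → EuclideanSpace ℝ (Fin d) → ℝ} {u θ w : ℕ → Ω → EuclideanSpace ℝ (Fin d)}

/-- A run does not postulate that `θ` and `w` are adapted; this follows inductively from continuity
of the argmax map. -/
lemma IsRun.measurable_state (hrun : IsRun μ ℱ T W r η δ f u θ w)
    (hN : ∀ x, N x = 0 → x = 0) (hr : IsStronglyConvexOn N W r)
    (hf : ∀ t < T, ∀ ω, Continuous (f t ω)) :
    ∀ t < T, Measurable[ℱ t] (θ t) ∧ Measurable[ℱ t] (w t) := by
  obtain ⟨Ψ, hΨ, hΨw⟩ := hr.exists_continuous_argmax hN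
  have hw : ∀ t < T, Measurable[ℱ t] (θ t) → Measurable[ℱ t] (w t) := by
    intro t ht h
    have : w t = fun ω => Ψ (θ t ω) :=
      funext fun ω => hΨw _ _ (hrun.predict t ht ω).1 (hrun.predict t ht ω).2
    rw [this]
    exact hΨ.measurable.comp h
  intro t
  induction t with
  | zero =>
    intro ht
    have h0 : Measurable[ℱ 0] (θ 0) := by
      have : θ 0 = fun _ => 0 := funext hrun.init
      rw [this]
      exact measurable_const
    exact ⟨h0, hw 0 ht h0⟩
  | succ t ih =>
    intro ht
    have ht' : t < T := by omega
    obtain ⟨h1, h2⟩ := ih ht'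
    have hle : ℱ t ≤ ℱ (t + 1) := ℱ.mono (Nat.le_succ t)
    have hg := measurable_gradEstimate (m := ℱ (t + 1))
      (fun x => (hrun.loss_adapted t ht' x).mono hle le_rfl) (hf t ht') (δ t)
      (h2.mono hle le_rfl)
    have hpair : Measurable[ℱ (t + 1), (ℱ (t + 1)).prod inferInstance]
        fun ω => (ω, u t ω) :=
      Measurable.prodMk measurable_id (hrun.dir_adapted t ht')
    have hθ : Measurable[ℱ (t + 1)] (θ (t + 1)) := by
      have : θ (t + 1) = fun ω => θ t ω - η • gradEstimate (δ t) (f t ω) (w t ω) (u t ω) :=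
        funext (hrun.update t ht')
      rw [this]
      exact (h1.mono hle le_rfl).sub ((hg.comp hpair).const_smul η)
    exact ⟨hθ, hw _ ht hθ⟩

lemma IsRun.integral_comp_direction [NeZero d] [IsProbabilityMeasure μ]
    (hrun : IsRun μ ℱ T W r η δ f u θ w) {t : ℕ} (ht : t < T)
    {K : Ω → EuclideanSpace ℝ (Fin d) → ℝ} {B : ℝ}
    (hK : Measurable[(ℱ t).prod inferInstance]
      fun q : Ω × EuclideanSpace ℝ (Fin d) => K q.1 q.2)
    (hB : ∀ ω v, ‖v‖ = 1 → |K ω v| ≤ B) :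
    Integrable (fun ω => K ω (u t ω)) μ ∧
      Integrable (fun ω => ∫ v, K ω v ∂uniformSphere d) μ ∧
      ∫ ω, K ω (u t ω) ∂μ = ∫ ω, ∫ v, K ω v ∂uniformSphere d ∂μ := by
  -- The frozen variable is the identity from `Ω` to `Ω` with the σ-algebra `ℱ t`: it carries the
  -- whole past, including the random function `f t`.
  have hind : @IndepFun Ω Ω (EuclideanSpace ℝ (Fin d)) mΩ (ℱ t) inferInstance id (u t) μ := by
    have h : Indep ((ℱ t).comap id) (MeasurableSpace.comap (u t) inferInstance) μ := by
      rw [MeasurableSpace.comap_id]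
      exact (hrun.dir_indep t ht).symm
    exact h
  exact @integral_comp_uniform_direction d Ω Ω mΩ (ℱ t) μ _ id (u t) K B _
    (measurable_id'' (ℱ.le t)) ((hrun.dir_adapted t ht).mono (ℱ.le _) le_rfl)
    (hrun.dir_law t ht) hind hK hB

end Run

/-! ### Expected regret -/

section RegretBound

variable {d : ℕ} {Ω : Type*} [mΩ : MeasurableSpace Ω] {μ : Measure Ω} {ℱ : Filtration ℕ mΩ}
  {T : ℕ} {W : Set (EuclideanSpace ℝ (Fin d))} {N : Seminorm ℝ (EuclideanSpace ℝ (Fin d))}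
  {r : EuclideanSpace ℝ (Fin d) → ℝ} {η G R p : ℝ} {δ : ℕ → ℝ}
  {f : ℕ → Ω → EuclideanSpace ℝ (Fin d) → ℝ} {u θ w : ℕ → Ω → EuclideanSpace ℝ (Fin d)}

/-- In a single round, the instantaneous regret is integrable, it is controlled by the expected
linearized regret, and the estimator has a bounded second moment in the dual norm. -/
lemma IsRun.round_bounds [NeZero d] [IsProbabilityMeasure μ]
    (hrun : IsRun μ ℱ T W r η δ f u θ w) (hN : ∀ x, N x = 0 → x = 0)
    (hr : IsStronglyConvexOn N W r) (hR : ∀ x ∈ W, ∀ y ∈ W, r x - r y ≤ R ^ 2)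
    (hG : 0 < G) (hp : 0 < p) (hp4 : ∫ v, dualNorm N v ^ 4 ∂uniformSphere d ≤ p ^ 4)
    (hconv : ∀ t < T, ∀ ω, ConvexOn ℝ Set.univ (f t ω))
    (hlip : ∀ t < T, ∀ ω x y, |f t ω x - f t ω y| ≤ G * ‖x - y‖)
    {x : EuclideanSpace ℝ (Fin d)} (hx : x ∈ W) {t : ℕ} (ht : t < T) (hδ : 0 < δ t) :
    Integrable (fun ω => f t ω (w t ω) - f t ω x) μ ∧
    Integrable (fun ω => inner ℝ (gradEstimate (δ t) (f t ω) (w t ω) (u t ω)) (w t ω - x)) μ ∧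
    Integrable (fun ω => dualNorm N (gradEstimate (δ t) (f t ω) (w t ω) (u t ω)) ^ 2) μ ∧
    ∫ ω, (f t ω (w t ω) - f t ω x) ∂μ ≤
      ∫ ω, inner ℝ (gradEstimate (δ t) (f t ω) (w t ω) (u t ω)) (w t ω - x) ∂μ +
        2 * δ t * G ∧
    ∫ ω, dualNorm N (gradEstimate (δ t) (f t ω) (w t ω) (u t ω)) ^ 2 ∂μ ≤
      √(sphereConst + 1) * d * p ^ 2 * G ^ 2 := by
  have hcont : ∀ t < T, ∀ ω, Continuous (f t ω) := fun t ht ω =>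
    (lipschitzWith_of_abs_sub_le (hlip t ht ω)).continuous
  obtain ⟨-, hw⟩ := hrun.measurable_state hN hr hcont t ht
  obtain ⟨D, hD⟩ := hr.exists_norm_sub_le hN hR
  obtain ⟨c, hc, hcN⟩ := exists_dualNorm_le_mul_norm hN
  have hg := measurable_gradEstimate (m := ℱ t) (hrun.loss_adapted t ht) (hcont t ht) (δ t) hw
  have hwW : ∀ ω, ‖w t ω - x‖ ≤ D := fun ω => hD _ (hrun.predict t ht ω).1 _ hx
  have hgB : ∀ ω v, ‖v‖ = 1 → ‖gradEstimate (δ t) (f t ω) (w t ω) v‖ ≤ d * G :=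
    fun ω v hv => norm_gradEstimate_le hδ (hlip t ht ω) _ hv
  have hreg : Integrable (fun ω => f t ω (w t ω) - f t ω x) μ := by
    have hfw : Measurable[ℱ t] fun ω => f t ω (w t ω) :=
      (measurable_uncurry_loss (m := ℱ t) (hrun.loss_adapted t ht) (hcont t ht)).comp
        (Measurable.prodMk measurable_id hw)
    refine Integrable.of_bound
      ((hfw.sub (hrun.loss_adapted t ht x)).mono (ℱ.le t) le_rfl).aestronglyMeasurable (G * D)
      (.of_forall fun ω => (hlip t ht ω _ _).trans ?_)
    exact mul_le_mul_of_nonneg_left (hwW ω) hG.le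
  obtain ⟨hK1, hK2, hK3⟩ := hrun.integral_comp_direction ht
    (K := fun ω v => inner ℝ (gradEstimate (δ t) (f t ω) (w t ω) v) (w t ω - x))
    (B := d * G * D)
    (hg.inner ((hw.comp measurable_fst).sub measurable_const)) fun ω v hv =>
      (abs_real_inner_le_norm _ _).trans
        (mul_le_mul (hgB ω v hv) (hwW ω) (norm_nonneg _) (by positivity))
  obtain ⟨hQ1, hQ2, hQ3⟩ := hrun.integral_comp_direction ht
    (K := fun ω v => dualNorm N (gradEstimate (δ t) (f t ω) (w t ω) v) ^ 2)
    (B := (c * (d * G)) ^ 2)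
    (((continuous_dualNorm hN).measurable.comp hg).pow_const 2) fun ω v hv => by
      rw [abs_pow, abs_of_nonneg (dualNorm_nonneg hN _)]
      exact pow_le_pow_left₀ (dualNorm_nonneg hN _)
        ((hcN _).trans (mul_le_mul_of_nonneg_left (hgB ω v hv) hc.le)) 2
  refine ⟨hreg, hK1, hQ1, ?_, ?_⟩
  · have h := integral_mono (hreg.sub (integrable_const (2 * δ t * G))) hK2 fun ω =>
      sub_le_integral_inner_gradEstimate hG.le hδ (hlip t ht ω) (hconv t ht ω) (w t ω) x
    rw [← hK3, integral_sub' hreg (integrable_const _), integral_const, probReal_univ,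
      one_smul] at h
    linarith
  · have h := integral_mono hQ2
      (integrable_const (√(sphereConst + 1) * d * p ^ 2 * G ^ 2)) fun ω =>
        integral_dualNorm_gradEstimate_sq_le hN hG hδ hp hp4 (hlip t ht ω) (w t ω)
    rw [← hQ3, integral_const, probReal_univ, one_smul] at h
    exact h

/-- The expected cumulative regret for an arbitrary positive step size. -/
lemma IsRun.integral_regret_le [NeZero d] [IsProbabilityMeasure μ]
    (hrun : IsRun μ ℱ T W r η δ f u θ w) (hT : 0 < T) (hη : 0 < η) (hN : ∀ x, N x = 0 → x = 0)
    (hr : IsStronglyConvexOn N W r) (hR : ∀ x ∈ W, ∀ y ∈ W, r x - r y ≤ R ^ 2)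
    (hG : 0 < G) (hp : 0 < p) (hp4 : ∫ v, dualNorm N v ^ 4 ∂uniformSphere d ≤ p ^ 4)
    (hconv : ∀ t < T, ∀ ω, ConvexOn ℝ Set.univ (f t ω))
    (hlip : ∀ t < T, ∀ ω x y, |f t ω x - f t ω y| ≤ G * ‖x - y‖)
    {x : EuclideanSpace ℝ (Fin d)} (hx : x ∈ W) {Δ : ℝ} (hδ : ∀ t < T, 0 < δ t ∧ δ t ≤ Δ) :
    Integrable (fun ω => ∑ t ∈ Finset.range T, (f t ω (w t ω) - f t ω x)) μ ∧
    ∫ ω, ∑ t ∈ Finset.range T, (f t ω (w t ω) - f t ω x) ∂μ ≤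
      R ^ 2 / η + η / 2 * (T * (√(sphereConst + 1) * d * p ^ 2 * G ^ 2)) + T * (2 * Δ * G) := by
  have hb := fun t (ht : t ∈ Finset.range T) =>
    hrun.round_bounds hN hr hR hG hp hp4 hconv hlip hx (Finset.mem_range.1 ht)
      (hδ t (Finset.mem_range.1 ht)).1
  have hint := integrable_finsetSum (Finset.range T) fun t ht => (hb t ht).1
  refine ⟨hint, ?_⟩
  set B := √(sphereConst + 1) * d * p ^ 2 * G ^ 2
  -- The mirror descent bound on each path, divided by `η`, with `r x - r (w 0) ≤ R²`.
  have hpath : ∀ ω, ∑ t ∈ Finset.range T,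
      inner ℝ (gradEstimate (δ t) (f t ω) (w t ω) (u t ω)) (w t ω - x) ≤
      R ^ 2 / η + η / 2 * ∑ t ∈ Finset.range T,
        dualNorm N (gradEstimate (δ t) (f t ω) (w t ω) (u t ω)) ^ 2 := by
    intro ω
    have h1 := hr.regret_le hN hT (η := η) (θ := fun t => θ t ω) (w := fun t => w t ω)
      (g := fun t => gradEstimate (δ t) (f t ω) (w t ω) (u t ω)) (hrun.init ω)
      (fun t ht => hrun.predict t ht ω) (fun t ht => hrun.update t ht ω) hx
    have h2 := hR x hx _ (hrun.predict 0 hT ω).1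
    refine le_of_mul_le_mul_left (h1.trans ?_) hη
    rw [mul_add, mul_div_cancel₀ _ hη.ne']
    linarith
  have hKint := integrable_finsetSum (Finset.range T) fun t ht => (hb t ht).2.1
  have hQint := integrable_finsetSum (Finset.range T) fun t ht => (hb t ht).2.2.1
  have hmean := integral_mono hKint
    ((integrable_const (R ^ 2 / η)).add (hQint.const_mul (η / 2))) hpath
  rw [integral_add' (integrable_const _) (hQint.const_mul _), integral_const, probReal_univ,
    one_smul, integral_const_mul, integral_finsetSum _ fun t ht => (hb t ht).2.1,
    integral_finsetSum _ fun t ht => (hb t ht).2.2.1] at hmean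
  rw [integral_finsetSum _ fun t ht => (hb t ht).1]
  have h1 := Finset.sum_le_sum fun t ht => (hb t ht).2.2.2.1
  have h2 : ∑ t ∈ Finset.range T, 2 * δ t * G ≤ T * (2 * Δ * G) := by
    refine (Finset.sum_le_card_nsmul _ _ (2 * Δ * G) fun t ht => ?_).trans_eq (by simp)
    have := (hδ t (Finset.mem_range.1 ht)).2
    gcongr
  have h3 : ∑ t ∈ Finset.range T,
      ∫ ω, dualNorm N (gradEstimate (δ t) (f t ω) (w t ω) (u t ω)) ^ 2 ∂μ ≤ T * B :=
    (Finset.sum_le_card_nsmul _ _ B fun t ht => (hb t ht).2.2.2.2).trans_eq (by simp)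
  rw [Finset.sum_add_distrib] at h1
  have h4 := mul_le_mul_of_nonneg_left h3 (by positivity : 0 ≤ η / 2)
  linarith

end RegretBound

end TwoPointBandit

/-! ### The main theorem: choice of parameters -/

theorem theorem1 :
    ∃ c : ℝ, 0 < c ∧
      ∀ (d T : ℕ), 1 ≤ d → 1 ≤ T →
      -- the domain, the norm and the regularizer
      ∀ (W : Set (EuclideanSpace ℝ (Fin d))) (N : Seminorm ℝ (EuclideanSpace ℝ (Fin d)))
        (r : EuclideanSpace ℝ (Fin d) → ℝ) (R G p : ℝ),
        IsClosed W → Convex ℝ W → (∀ x, N x = 0 → x = 0) →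
        0 < R → 0 < G →
        TwoPointBandit.IsStronglyConvexOn N W r →
        (∀ x ∈ W, ∀ y ∈ W, r x - r y ≤ R ^ 2) →
        (∫ v, TwoPointBandit.dualNorm N v ^ 4 ∂TwoPointBandit.uniformSphere d) ^ (1 / 4 : ℝ) ≤ p →
      -- the exploration parameters
      ∀ (δ : ℕ → ℝ), (∀ t < T, 0 < δ t ∧ δ t ≤ p * R * √((d : ℝ) / T)) →
      -- the losses and the run of the algorithm
      ∀ {Ω : Type*} [mΩ : MeasurableSpace Ω] (μ : MeasureTheory.Measure Ω)
        [MeasureTheory.IsProbabilityMeasure μ]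
        (ℱ : MeasureTheory.Filtration ℕ mΩ)
        (f : ℕ → Ω → EuclideanSpace ℝ (Fin d) → ℝ)
        (u θ w : ℕ → Ω → EuclideanSpace ℝ (Fin d)),
        (∀ t < T, ∀ ω, ConvexOn ℝ Set.univ (f t ω)) →
        (∀ t < T, ∀ ω x y, |f t ω x - f t ω y| ≤ G * ‖x - y‖) →
        TwoPointBandit.IsRun μ ℱ T W r (R / (p * G * √((d : ℝ) * T))) δ f u θ w →
      ∀ wstar ∈ W,
        MeasureTheory.Integrable (fun ω => 1 / (T : ℝ) * ∑ t ∈ Finset.range T, f t ω (w t ω)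
          - 1 / (T : ℝ) * ∑ t ∈ Finset.range T, f t ω wstar) μ ∧
        ∫ ω, (1 / (T : ℝ) * ∑ t ∈ Finset.range T, f t ω (w t ω)
          - 1 / (T : ℝ) * ∑ t ∈ Finset.range T, f t ω wstar) ∂μ
          ≤ c * p * G * R * √((d : ℝ) / T) := by
  -- In units of `p G R √(d/T)`, the term `R² / η` contributes `1`, the smoothing bias `2`, and the
  -- second moment `√(sphereConst + 1) / 2`.
  refine ⟨3 + √(TwoPointBandit.sphereConst + 1) / 2, by positivity, ?_⟩
  intro d T hd hT W N r R G p _ _ hN hR hG hr hrR hp δ hδ Ω mΩ μ _ ℱ f u θ w hconv hlip hrun x hx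
  have : NeZero d := ⟨by omega⟩
  have hI := TwoPointBandit.integral_dualNorm_pow_four_pos hN
  have hp0 : 0 < p := (Real.rpow_pos_of_pos hI _).trans_le hp
  have hp4 : ∫ v, TwoPointBandit.dualNorm N v ^ 4 ∂TwoPointBandit.uniformSphere d ≤ p ^ 4 := by
    have h := pow_le_pow_left₀ (Real.rpow_nonneg hI.le _) hp 4
    rwa [← Real.rpow_natCast, ← Real.rpow_mul hI.le, Nat.cast_ofNat,
      one_div_mul_cancel (by norm_num), Real.rpow_one] at h
  have hd0 : (0 : ℝ) < d := by exact_mod_cast hd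
  have hT0 : (0 : ℝ) < T := by exact_mod_cast hT
  set s := √((d : ℝ) / T) with hs
  have hs0 : 0 < s := Real.sqrt_pos.2 (by positivity)
  -- Writing `d = s² T` and `√(dT) = s T` removes all roots of `d` and `T`, so the last identity is
  -- rational.
  have hsd : (d : ℝ) = s ^ 2 * T := by
    rw [hs, Real.sq_sqrt (by positivity), div_mul_cancel₀ _ hT0.ne']
  have hsT : √((d : ℝ) * T) = s * T := by
    rw [hsd, show s ^ 2 * (T : ℝ) * T = (s * T) ^ 2 by ring, Real.sqrt_sq (by positivity)]
  obtain ⟨hint, hle⟩ := hrun.integral_regret_le hT (by positivity) hN hr hrR hG hp0 hp4 hconv hlip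
    hx hδ
  have heq : (fun ω => 1 / (T : ℝ) * ∑ t ∈ Finset.range T, f t ω (w t ω)
      - 1 / (T : ℝ) * ∑ t ∈ Finset.range T, f t ω x) =
      fun ω => 1 / (T : ℝ) * ∑ t ∈ Finset.range T, (f t ω (w t ω) - f t ω x) := by
    ext ω
    rw [Finset.sum_sub_distrib, mul_sub]
  rw [heq]
  refine ⟨hint.const_mul _, ?_⟩
  rw [MeasureTheory.integral_const_mul]
  refine (mul_le_mul_of_nonneg_left hle (by positivity)).trans_eq ?_
  rw [hsT]
  generalize √(TwoPointBandit.sphereConst + 1) = C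
  clear_value s
  rw [hsd]
  field_simp
  ring
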